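/- A semigroup $S$ is \emph{regular} if for every $a\in S$ there is $b\in S$ with $aba=a$. A regular semigroup $S$ is \emph{weakly generated} by $x\in S$ if no proper subsemigroup of $S$ that contains $x$ is regular (as a semigroup). \emph{The semigroup $F_1$.} Let $A=\{1,x,x'\}$ be a three-element set of symbols (``anchors'') with the involution $1'=1$, $(x)'=x'$, $(x')'=x$. Write a 5-tuple as $g=(g^l,g^{la},g^c,g^{ra},g^r)$. Put $g_{xx'}=(1,1,x,x',1)$, $G_{1,e}=\{g_{xx'}\}$, and for $i\ge 2$ $$G_{i,e}=\{(g,(g^{la})',g^l,(g^{ra})',g),\ (g,(g^{ra})',g^l,(g^{la})',g)\;:\;g\in G_{i-1,e}\}.$$ Put $G_{1,d}=G_{2,d}=\emptyset$, $G_i=G_{i,e}\cup G_{i,d}$, and for $i\ge 3$ let $G_{i,d}$ be the set of all $g\in G_{i-1}\times A\times G_{i-2}\times A\times G_{i-1}$ such that $g^l\ne g^r$, the pair $(g^c,g^{la})$ equals $(h^l,(h^{la})')$ or $(h^r,(h^{ra})')$ for $h=g^l$, and the pair $(g^c,g^{ra})$ equals $(h^l,(h^{la})')$ or $(h^r,(h^{ra})')$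 for $h=g^r$. Let $G=A\cup\bigcup_{i\ge1}G_i$, and let $\rho$ be the smallest congruence on the free semigroup $G^+$ containing the pairs - $(xx'x,\,x)$, $(x'xx',\,x')$, $(g_{xx'},\,xx')$; - $(1g,\,g)$ and $(g1,\,g)$ for all $g\in G$; - $(g^2,\,g)$ for all $g\in\{1\}\cup\bigcup_{i\ge1}G_i$; - for all $g\in G_i$ with $i\ge 2$, writing $g^L$ and $g^R$ for the words $(g^{la})'\,g^l\,g^{la}$ and $(g^{ra})'\,g^r\,g^{ra}$ of length three: $(g^c g^L g,\,g)$, $(g\,g^R g^c,\,g)$ and $(g^r\,g^{ra}\,g\,(g^{la})'\,g^l,\; g^r\,g^{ra}\,g^c\,(g^{la})'\,g^l)$. Then $G^+/\rho$ is a monoid with identity the class $[1]$, its non-identity elements form a subsemigroup, and $F_1=(G^+/\rho)\setminus\{[1]\}$. \textbf{Proposition.} Let $T$ be a regular semigroup weakly generated by $x\in T$. Suppose that for every regular semigroup $S$ weakly generated by an element $y\in S$ there is a surjective semigroup homomorphism $T\to S$ that maps $x$ to $y$. Then $T$ and $F_1$ are isomorphic semigroups. -/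

import Mathlib

/-! ### Regular semigroups and weak generation -/

/-- A semigroup is regular if every element `a` has some `b` with `a * b * a = a`. -/
def IsRegularSemigroup (S : Type*) [Semigroup S] : Prop :=
  ∀ a : S, ∃ b : S, a * b * a = a

/-- `S` is a regular semigroup that is weakly generated by its element `x`: it is regular and has no
proper regular subsemigroup containing `x`. -/
def IsRegularWeaklyGeneratedBy (S : Type*) [Semigroup S] (x : S) : Prop :=
  IsRegularSemigroup S ∧
    ∀ R : Subsemigroup S, x ∈ R → IsRegularSemigroup R → R = ⊤

namespace FOne

/-! ### The generators -/

/-- The set `A = {1, x, x'}` of anchors. -/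
inductive Anchor
  | one
  | x
  | xinv

/-- The involution of `A`: it fixes `1` and exchanges `x` and `x'`. -/
def Anchor.inv : Anchor → Anchor
  | one => one
  | x => xinv
  | xinv => x

/-- All formal nested 5-tuples `(l, la, c, ra, r)` over the anchors. The generators of the
presentation are some of these; see `G`. -/
inductive Letter
  | anchor (a : Anchor)
  | tuple (l : Letter) (la : Anchor) (c : Letter) (ra : Anchor) (r : Letter)

namespace Letter

/-- Left entry of a 5-tuple (an anchor has no entries, and is returned unchanged). -/
def left : Letter → Letter
  | tuple l _ _ _ _ => l
  | anchor a => anchor a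

/-- Left anchor of a 5-tuple (on anchors this is a dummy value). -/
def leftAnchor : Letter → Anchor
  | tuple _ la _ _ _ => la
  | anchor _ => .one

/-- Right anchor of a 5-tuple (on anchors this is a dummy value). -/
def rightAnchor : Letter → Anchor
  | tuple _ _ _ ra _ => ra
  | anchor _ => .one

/-- Right entry of a 5-tuple (an anchor has no entries, and is returned unchanged). -/
def right : Letter → Letter
  | tuple _ _ _ _ r => r
  | anchor a => anchor a

end Letter

open Letter

/-- The 5-tuple `(1, 1, x, x', 1)`. -/
def gxx : Letter := tuple (anchor .one) .one (anchor .x) .xinv (anchor .one)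

/-- The sets `G_{i,e}` (with the convention `G_{0,e} = {1}`). -/
def GE : ℕ → Set Letter
  | 0 => {anchor .one}
  | 1 => {gxx}
  | i + 2 => {h | ∃ g ∈ GE (i + 1),
      h = tuple g g.leftAnchor.inv g.left g.rightAnchor.inv g ∨
      h = tuple g g.rightAnchor.inv g.left g.leftAnchor.inv g}

/-- The sets `G_{i,d}`. -/
def GD : ℕ → Set Letter
  | 0 => ∅
  | 1 => ∅
  | 2 => ∅
  | i + 3 => {h | ∃ l la c ra r, h = tuple l la c ra r ∧
      l ∈ GE (i + 2) ∪ GD (i + 2) ∧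
      c ∈ GE (i + 1) ∪ GD (i + 1) ∧
      r ∈ GE (i + 2) ∪ GD (i + 2) ∧
      l ≠ r ∧
      ((c, la) = (l.left, l.leftAnchor.inv) ∨ (c, la) = (l.right, l.rightAnchor.inv)) ∧
      ((c, ra) = (r.left, r.leftAnchor.inv) ∨ (c, ra) = (r.right, r.rightAnchor.inv))}

/-- `G_i = G_{i,e} ∪ G_{i,d}`, the letters of height `i` (with `G_0 = {1}`). -/
def GH (i : ℕ) : Set Letter := GE i ∪ GD i

/-- The generating set `G = A ∪ G_1 ∪ G_2 ∪ ⋯`. -/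
def G : Set Letter := {g | (∃ a, g = anchor a) ∨ ∃ i, 1 ≤ i ∧ g ∈ GH i}

/-- The generators, as a type. -/
abbrev Gen : Type := G

/-- An anchor as a generator. -/
def Gen.ofAnchor (a : Anchor) : Gen := ⟨anchor a, Or.inl ⟨a, rfl⟩⟩

/-- The 5-tuple `(1, 1, x, x', 1)` as a generator. -/
def Gen.gxx : Gen := ⟨FOne.gxx, Or.inr ⟨1, le_rfl, Or.inl rfl⟩⟩

/-- Entries of a letter of height at least two are letters of the two preceding heights. -/
theorem entries_mem {l c r : Letter} {la ra : Anchor} {i : ℕ}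
    (h : tuple l la c ra r ∈ GH (i + 2)) : l ∈ GH (i + 1) ∧ c ∈ GH i ∧ r ∈ GH (i + 1) := by
  rcases h with h | h
  · obtain ⟨g, hg, h⟩ := h
    have hc : g.left ∈ GE i := by
      cases i with
      | zero => rw [show g = gxx from hg]; rfl
      | succ i => obtain ⟨k, hk, rfl | rfl⟩ := hg <;> exact hk
    rcases h with h | h <;> cases h <;> exact ⟨Or.inl hg, Or.inl hc, Or.inl hg⟩
  · cases i with
    | zero => exact h.elim
    | succ i =>
      obtain ⟨l', la', c', ra', r', h, hl, hc, hr, -⟩ := h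
      cases h
      exact ⟨hl, hc, hr⟩

/-- Letters of positive height are 5-tuples. -/
theorem anchor_notMem (a : Anchor) (i : ℕ) : anchor a ∉ GH (i + 1) := by
  rintro (h | h)
  · cases i with
    | zero => cases h
    | succ i => obtain ⟨g, -, h | h⟩ := h <;> cases h
  · match i, h with
    | 0, h => exact h
    | 1, h => exact h
    | i + 2, h => obtain ⟨_, _, _, _, _, h, -⟩ := h; cases h

/-! ### The relations and the semigroup -/

/-- A generator as a word of length one in the free semigroup on the generators. -/
abbrev w (g : Gen) : FreeSemigroup Gen := FreeSemigroup.of g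

/-- An anchor as a word of length one in the free semigroup on the generators. -/
abbrev wa (a : Anchor) : FreeSemigroup Gen := FreeSemigroup.of (Gen.ofAnchor a)

/-- The defining relations. In the last three, `g = (l, la, c, ra, r)` has height at least two. -/
inductive Rel : FreeSemigroup Gen → FreeSemigroup Gen → Prop
  /-- `x x' x = x` -/
  | x_xinv_x : Rel (wa .x * wa .xinv * wa .x) (wa .x)
  /-- `x' x x' = x'` -/
  | xinv_x_xinv : Rel (wa .xinv * wa .x * wa .xinv) (wa .xinv)
  /-- `(1, 1, x, x', 1) = x x'` -/
  | gxx_eq : Rel (w Gen.gxx) (wa .x * wa .xinv)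
  /-- `1 g = g` for every generator `g` -/
  | one_mul (g : Gen) : Rel (wa .one * w g) (w g)
  /-- `g 1 = g` for every generator `g` -/
  | mul_one (g : Gen) : Rel (w g * wa .one) (w g)
  /-- `g g = g` for every generator `g` which is a 5-tuple or `1` -/
  | idem (g : Gen) (i : ℕ) (hg : g.1 ∈ GH i) : Rel (w g * w g) (w g)
  /-- `c (la' l la) g = g` -/
  | left_absorb (g l c r : Gen) (la ra : Anchor) (i : ℕ) (hi : 2 ≤ i) (hg : g.1 ∈ GH i)
      (he : g.1 = tuple l.1 la c.1 ra r.1) :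
      Rel (w c * (wa la.inv * w l * wa la) * w g) (w g)
  /-- `g (ra' r ra) c = g` -/
  | right_absorb (g l c r : Gen) (la ra : Anchor) (i : ℕ) (hi : 2 ≤ i) (hg : g.1 ∈ GH i)
      (he : g.1 = tuple l.1 la c.1 ra r.1) :
      Rel (w g * (wa ra.inv * w r * wa ra) * w c) (w g)
  /-- `r ra g la' l = r ra c la' l` -/
  | sandwich (g l c r : Gen) (la ra : Anchor) (i : ℕ) (hi : 2 ≤ i) (hg : g.1 ∈ GH i)
      (he : g.1 = tuple l.1 la c.1 ra r.1) :
      Rel (w r * wa ra * w g * wa la.inv * w l) (w r * wa ra * w c * wa la.inv * w l)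

/-- The monoid `F_1^1`: the free semigroup on the generators modulo the congruence generated by the
defining relations. -/
abbrev FOneOne : Type := (conGen Rel).Quotient

/-- The class of a word. -/
def cls (u : FreeSemigroup Gen) : FOneOne := (u : (conGen Rel).Quotient)

open Classical in
/-- The homomorphism to `(ℕ, ·)` that maps a word to `1` if it has content `{1}`, else to `0`. -/
noncomputable def chi : FreeSemigroup Gen →ₙ* ℕ :=
  FreeSemigroup.lift fun g => if g = Gen.ofAnchor .one then 1 else 0

theorem chi_w_of_ne {g : Gen} (h : g.1 ≠ anchor .one) : chi (w g) = 0 := by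
  have : g ≠ Gen.ofAnchor .one := fun e => h (by rw [e]; rfl)
  simp [chi, this]

theorem chi_one : chi (wa .one) = 1 := by simp [chi]

theorem chi_eq_of_rel {u v : FreeSemigroup Gen} (h : Rel u v) : chi u = chi v := by
  have hx : chi (wa .x) = 0 := chi_w_of_ne (by simp [Gen.ofAnchor])
  have hx' : chi (wa .xinv) = 0 := chi_w_of_ne (by simp [Gen.ofAnchor])
  have hg : ∀ g : Gen, chi (w g) * chi (w g) = chi (w g) := by
    intro g
    by_cases h : g = Gen.ofAnchor .one <;> simp [chi, h]
  have ht : ∀ {g l c r : Gen} {la ra : Anchor}, g.1 = tuple l.1 la c.1 ra r.1 →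
      chi (w g) = 0 := fun he => chi_w_of_ne (by rw [he]; exact Letter.noConfusion)
  cases h with
  | x_xinv_x => simp only [map_mul, hx, hx', mul_zero]
  | xinv_x_xinv => simp only [map_mul, hx, hx', mul_zero]
  | gxx_eq =>
    rw [map_mul, hx, hx', chi_w_of_ne]
    exact fun e => by cases e
  | one_mul g => rw [map_mul, chi_one, Nat.one_mul]
  | mul_one g => rw [map_mul, chi_one, Nat.mul_one]
  | idem g => rw [map_mul, hg]
  | left_absorb g l c r la ra i hi hg he => simp only [map_mul, ht he, mul_zero]
  | right_absorb g l c r la ra i hi hg he => simp only [map_mul, ht he, zero_mul]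
  | sandwich g l c r la ra i hi hg he =>
    have hl : chi (w l) = 0 := by
      obtain ⟨j, rfl⟩ := Nat.exists_eq_add_of_le' hi
      rw [he] at hg
      exact chi_w_of_ne fun e => anchor_notMem .one j (e ▸ (entries_mem hg).1)
    simp only [map_mul, hl, mul_zero]

theorem cls_eq_one_iff (u : FreeSemigroup Gen) : cls u = cls (wa .one) ↔ chi u = 1 := by
  constructor
  · intro h
    have h1 : conGen Rel u (wa .one) := (Con.eq _).1 h
    have h2 : conGen Rel ≤ Con.ker chi := Con.conGen_le.2 fun _ _ h => chi_eq_of_rel h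
    exact (h2 h1 : chi u = chi (wa .one)).trans chi_one
  · intro h
    induction u with
    | ih1 g =>
      by_cases hg : g = Gen.ofAnchor .one
      · rw [hg]
      · simp [chi, hg] at h
    | ih2 g v hg hv =>
      rw [map_mul] at h
      have e1 := hg (Nat.eq_one_of_mul_eq_one_right h)
      have e2 := hv (Nat.eq_one_of_mul_eq_one_left h)
      have e3 : cls (wa .one * wa .one) = cls (wa .one) :=
        (Con.eq _).2 (ConGen.Rel.of _ _ (Rel.one_mul _))
      change cls (w g) * cls v = _
      rw [show cls (w g) = _ from e1, e2]
      exact e3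

/-- `F_1`, the subsemigroup `F_1^1 ∖ {[1]}` of `F_1^1`. -/
def F1Sub : Subsemigroup FOneOne where
  carrier := {u | u ≠ cls (wa .one)}
  mul_mem' := by
    rintro ⟨u⟩ ⟨v⟩ hu - h
    have h' : chi (u * v) = 1 := (cls_eq_one_iff (u * v)).1 h
    rw [map_mul] at h'
    exact hu ((cls_eq_one_iff u).2 (Nat.eq_one_of_mul_eq_one_right h'))

/-- The semigroup `F_1`. -/
abbrev F1 : Type := F1Sub

end FOne

namespace FOne

open Letter

/-! ### Edges between letters -/

/-! Three facts about F_1 suffice: it is regular; every element of a regular semigroup is the image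
of x under a homomorphism from F_1 (`exists_hom_of_isRegular`); and only the identity endomorphism
fixes x (`endo_eq_id`). Weak generation by x follows from them. A homomorphism F_1 → T with x ↦ x is
onto, because its image is regular and contains x; followed by a map T → F_1 given by universality
it is an endomorphism fixing x, hence the identity, so it is also injective.

Homomorphisms are built by sending g = (l, la, c, ra, r) to c la' l θ* r ra c, where θ* is a chosen
inverse of the image of θ = r ra c la' l.

For the other two facts, the letters of G_0 = {1}, G_1, G_2, … are viewed as the vertices of a
graded graph, in which g has labelled edges down to l and r. Going down and then up the same edge
cancels (`dn_mul_up`); going down one edge and up a different one into the same letter equals, by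
the sandwich relation, going up and then down over a new peak (`dn_mul_up_of_ne`). So every element
is an upward path followed by a downward path, and regularity follows. A representation on lists of
edges shows that going up an edge and back down is never trivial (`up_mul_dn_ne`). Hence the
one-sided inverses of edge values, between the right idempotents, are unique (`eq_dn_of_mul_up`,
`eq_up_of_dn_mul`). This makes x' the only inverse of x and, by induction on height, determines each
g from its entries (`map_el_eq_of_entries`), which is rigidity. -/

theorem Anchor.inv_inv (a : Anchor) : a.inv.inv = a := by cases a <;> rfl

/-- `(c, a)` is one of the two edges that lead down from the letter `g`. -/
def IsEdge (g c : Letter) (a : Anchor) : Prop :=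
  (c, a) = (g.left, g.leftAnchor) ∨ (c, a) = (g.right, g.rightAnchor)

/-- The height of a letter. -/
def height : Letter → ℕ
  | anchor _ => 0
  | tuple l _ _ _ _ => height l + 1

theorem mem_GH_zero {g : Letter} : g ∈ GH 0 ↔ g = anchor .one := by
  simp [GH, GE, GD]

theorem mem_GH_one {g : Letter} : g ∈ GH 1 ↔ g = gxx := by
  simp [GH, GE, GD]

theorem exists_tuple {g : Letter} {n : ℕ} (h : g ∈ GH (n + 1)) :
    ∃ l la c ra r, g = tuple l la c ra r := by
  cases g with
  | anchor a => exact (anchor_notMem a n h).elim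
  | tuple l la c ra r => exact ⟨l, la, c, ra, r, rfl⟩

/-- The levels are disjoint, so later arguments compare levels by comparing heights. -/
theorem height_of_mem {g : Letter} {n : ℕ} (h : g ∈ GH n) : height g = n := by
  induction n generalizing g with
  | zero => rw [mem_GH_zero.1 h]; rfl
  | succ n ih =>
    cases n with
    | zero => rw [mem_GH_one.1 h]; rfl
    | succ n =>
      obtain ⟨l, la, c, ra, r, rfl⟩ := exists_tuple h
      rw [height, ih (entries_mem h).1]

theorem IsEdge.mem {g c : Letter} {a : Anchor} {n : ℕ} (h : IsEdge g c a) (hg : g ∈ GH (n + 1)) :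
    c ∈ GH n := by
  cases n with
  | zero =>
    rw [mem_GH_one.1 hg] at h
    rw [mem_GH_zero]
    rcases h with h | h <;> cases h <;> rfl
  | succ n =>
    obtain ⟨l, la, d, ra, r, rfl⟩ := exists_tuple hg
    rcases h with h | h <;> cases h
    exacts [(entries_mem hg).1, (entries_mem hg).2.2]

/-- A letter whose two entries agree belongs to some `G_{i,e}`. -/
theorem mem_GE_of_left_eq_right {g : Letter} {n : ℕ} (hg : g ∈ GH n) (h : g.left = g.right) :
    g ∈ GE n := by
  rcases hg with hg | hg
  · exact hg
  · match n, hg with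
    | n + 3, hg =>
      obtain ⟨l, la, c, ra, r, rfl, -, -, -, hne, -⟩ := hg
      exact (hne h).elim

theorem GE_left_eq_right {g : Letter} {n : ℕ} (hg : g ∈ GE n) : g.left = g.right := by
  match n, hg with
  | 0, hg => cases hg; rfl
  | 1, hg => cases hg; rfl
  | n + 2, hg => obtain ⟨k, -, rfl | rfl⟩ := hg <;> rfl

theorem Anchor.inv_injective : Function.Injective Anchor.inv :=
  Function.LeftInverse.injective Anchor.inv_inv

/-- The anchors 1 and x' of `gxx` differ, and each step up only inverts and possibly swaps them. So
the two parallel edges below such a letter are distinct. -/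
theorem GE_leftAnchor_ne {g : Letter} {n : ℕ} (hg : g ∈ GE (n + 1)) :
    g.leftAnchor ≠ g.rightAnchor := by
  induction n generalizing g with
  | zero => cases hg; exact fun h => by cases h
  | succ n ih =>
    obtain ⟨k, hk, rfl | rfl⟩ := hg
    exacts [fun h => ih hk (Anchor.inv_injective h), fun h => ih hk (Anchor.inv_injective h.symm)]

/-- The edges below the entries of a letter. -/
theorem edges_of_mem {l c r : Letter} {la ra : Anchor} {n : ℕ}
    (h : tuple l la c ra r ∈ GH (n + 2)) :
    IsEdge l c la.inv ∧ IsEdge r c ra.inv ∧ (r, c, ra.inv) ≠ (l, c, la.inv) := by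
  rcases h with h | h
  · obtain ⟨g, hg, h⟩ := h
    have h1 := GE_left_eq_right hg
    have h2 := GE_leftAnchor_ne hg
    rcases h with h | h <;> cases h <;> simp [IsEdge, Anchor.inv_inv, h1, h2, h2.symm]
  · match n, h with
    | n + 1, h =>
      obtain ⟨l, la, c, ra, r, h, -, -, -, hne, h1, h2⟩ := h
      cases h
      refine ⟨?_, ?_, fun h => hne (congrArg Prod.fst h).symm⟩
      · rcases h1 with h1 | h1 <;> cases h1 <;> simp [IsEdge, Anchor.inv_inv]
      · rcases h2 with h2 | h2 <;> cases h2 <;> simp [IsEdge, Anchor.inv_inv]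

/-- Two distinct edges into a common letter are the valley of a letter two levels up. -/
theorem valley_mem {l c r : Letter} {a b : Anchor} {n : ℕ} (hl : l ∈ GH (n + 1))
    (hr : r ∈ GH (n + 1)) (hel : IsEdge l c b) (her : IsEdge r c a)
    (hne : (r, c, a) ≠ (l, c, b)) : tuple l b.inv c a.inv r ∈ GH (n + 2) := by
  by_cases hlr : l = r
  · subst hlr
    have hab : a ≠ b := fun h => hne (by rw [h])
    -- Edges of one letter into the same entry with different labels must be its left and its right
    -- edge.
    have key : l.left = l.right := by
      rcases hel with h1 | h1 <;> rcases her with h2 | h2 <;>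
        obtain ⟨h3, h4⟩ := Prod.mk.inj h1 <;> obtain ⟨h5, h6⟩ := Prod.mk.inj h2
      · exact (hab (h6.trans h4.symm)).elim
      · exact h3.symm.trans h5
      · exact h5.symm.trans h3
      · exact (hab (h6.trans h4.symm)).elim
    refine Or.inl ⟨l, mem_GE_of_left_eq_right hl key, ?_⟩
    rcases hel with h1 | h1 <;> rcases her with h2 | h2 <;>
        obtain ⟨h3, h4⟩ := Prod.mk.inj h1 <;> obtain ⟨h5, h6⟩ := Prod.mk.inj h2
    · exact (hab (h6.trans h4.symm)).elim
    · exact Or.inl (by rw [h4, h6, h3])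
    · exact Or.inr (by rw [h4, h6, h5])
    · exact (hab (h6.trans h4.symm)).elim
  · cases n with
    | zero => exact (hlr ((mem_GH_one.1 hl).trans (mem_GH_one.1 hr).symm)).elim
    | succ n =>
      refine Or.inr ⟨l, b.inv, c, a.inv, r, rfl, hl, hel.mem hl, hr, hlr, ?_, ?_⟩
      · rcases hel with h | h <;> cases h <;> simp
      · rcases her with h | h <;> cases h <;> simp

/-! ### Models of the defining relations -/

/-- A map from letters to a monoid that satisfies the defining relations of `F_1^1`. -/
structure IsModel {N : Type*} [Monoid N] (f : Letter → N) : Prop where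
  one : f (anchor .one) = 1
  x_xinv_x : f (anchor .x) * f (anchor .xinv) * f (anchor .x) = f (anchor .x)
  xinv_x_xinv : f (anchor .xinv) * f (anchor .x) * f (anchor .xinv) = f (anchor .xinv)
  gxx_eq : f gxx = f (anchor .x) * f (anchor .xinv)
  idem : ∀ {n g}, g ∈ GH n → f g * f g = f g
  left_absorb : ∀ {n l la c ra r}, tuple l la c ra r ∈ GH (n + 2) →
    f c * (f (anchor la.inv) * f l * f (anchor la)) * f (tuple l la c ra r) = f (tuple l la c ra r)
  right_absorb : ∀ {n l la c ra r}, tuple l la c ra r ∈ GH (n + 2) →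
    f (tuple l la c ra r) * (f (anchor ra.inv) * f r * f (anchor ra)) * f c = f (tuple l la c ra r)
  sandwich : ∀ {n l la c ra r}, tuple l la c ra r ∈ GH (n + 2) →
    f r * f (anchor ra) * f (tuple l la c ra r) * f (anchor la.inv) * f l =
      f r * f (anchor ra) * f c * f (anchor la.inv) * f l

/-- The value of an edge traversed upwards. -/
def up {N : Type*} [Monoid N] (f : Letter → N) (g c : Letter) (a : Anchor) : N :=
  f c * f (anchor a) * f g

/-- The value of an edge traversed downwards. -/
def dn {N : Type*} [Monoid N] (f : Letter → N) (g c : Letter) (a : Anchor) : N :=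
  f g * f (anchor a.inv) * f c

namespace IsModel

variable {N : Type*} [Monoid N] {f : Letter → N}

theorem center_mul (hf : IsModel f) {n : ℕ} {l c r : Letter} {la ra : Anchor}
    (h : tuple l la c ra r ∈ GH (n + 2)) :
    f c * f (tuple l la c ra r) = f (tuple l la c ra r) := by
  conv_lhs => rw [← hf.left_absorb h]
  simp only [← mul_assoc]
  rw [hf.idem (entries_mem h).2.1]
  simpa only [← mul_assoc] using hf.left_absorb h

theorem mul_center (hf : IsModel f) {n : ℕ} {l c r : Letter} {la ra : Anchor}
    (h : tuple l la c ra r ∈ GH (n + 2)) :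
    f (tuple l la c ra r) * f c = f (tuple l la c ra r) := by
  conv_lhs => rw [← hf.right_absorb h]
  rw [mul_assoc, hf.idem (entries_mem h).2.1]
  exact hf.right_absorb h

/-- Above level one, the centre can be inserted next to g because g absorbs it; then the absorption
law for the side of the edge removes the detour. For `gxx` the claim reduces to idempotency and x x'
= `gxx`. -/
theorem dn_mul_up (hf : IsModel f) {n : ℕ} {g c : Letter} {a : Anchor} (hg : g ∈ GH (n + 1))
    (he : IsEdge g c a) : dn f g c a * up f g c a = f g := by
  have hc := hf.idem (he.mem hg)
  have key : f g * f (anchor a.inv) * f c * f (anchor a) * f g = f g := by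
    cases n with
    | zero =>
      rw [mem_GH_one] at hg
      subst hg
      have hi := hf.idem (g := gxx) (n := 1) (mem_GH_one.2 rfl)
      rcases he with h | h <;> cases h
      · simp [Letter.left, Letter.leftAnchor, gxx, Anchor.inv, hf.one]
        exact hi
      · simp only [Letter.right, Letter.rightAnchor, gxx, Anchor.inv, hf.one, mul_one]
        change f gxx * f (anchor .x) * f (anchor .xinv) * f gxx = f gxx
        rw [mul_assoc (f gxx), ← hf.gxx_eq, hi, hi]
    | succ n =>
      obtain ⟨l, la, d, ra, r, rfl⟩ := exists_tuple hg
      rcases he with h | h <;> cases h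
      · have h1 := hf.left_absorb hg
        have h2 := hf.mul_center hg
        nth_rewrite 1 [← h2]
        simp only [left, leftAnchor, mul_assoc] at h1 ⊢
        rw [h1, hf.idem hg]
      · have h1 := hf.right_absorb hg
        have h2 := hf.center_mul hg
        nth_rewrite 2 [← h2]
        simp only [right, rightAnchor, ← mul_assoc] at h1 ⊢
        rw [h1, hf.idem hg]
  calc dn f g c a * up f g c a
      = f g * f (anchor a.inv) * (f c * f c) * f (anchor a) * f g := by
        simp only [up, dn, mul_assoc]
    _ = f g := by rw [hc, key]

/-- The sandwich relation, with the peak doubled by idempotency: a valley through c is replaced by a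
peak over the same two letters. -/
theorem dn_mul_up_of_ne (hf : IsModel f) {n : ℕ} {l c r : Letter} {a b : Anchor}
    (hl : l ∈ GH (n + 1)) (hr : r ∈ GH (n + 1)) (hel : IsEdge l c b) (her : IsEdge r c a)
    (hne : (r, c, a) ≠ (l, c, b)) :
    dn f r c a * up f l c b = up f (tuple l b.inv c a.inv r) r a.inv *
      dn f (tuple l b.inv c a.inv r) l b.inv := by
  have hk := valley_mem hl hr hel her hne
  have h1 := hf.sandwich hk
  have hc := hf.idem (her.mem hr)
  have h2 := hf.idem hk
  rw [Anchor.inv_inv] at h1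
  calc _ = f r * f (anchor a.inv) * (f c * f c) * f (anchor b) * f l := by
        simp only [up, dn, mul_assoc]
    _ = f r * f (anchor a.inv) * (f (tuple l b.inv c a.inv r) * f (tuple l b.inv c a.inv r)) *
          f (anchor b) * f l := by rw [hc, ← h1, h2]
    _ = _ := by simp only [up, dn, Anchor.inv_inv, mul_assoc]

theorem mul_up (hf : IsModel f) {n : ℕ} {g c : Letter} {a : Anchor} (hg : g ∈ GH (n + 1))
    (he : IsEdge g c a) : f c * up f g c a = up f g c a := by
  rw [up, ← mul_assoc, ← mul_assoc, hf.idem (he.mem hg)]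

theorem up_mul (hf : IsModel f) {n : ℕ} {g : Letter} (c : Letter) (a : Anchor)
    (hg : g ∈ GH (n + 1)) : up f g c a * f g = up f g c a := by
  rw [up, mul_assoc, hf.idem hg]

theorem mul_dn (hf : IsModel f) {n : ℕ} {g : Letter} (c : Letter) (a : Anchor)
    (hg : g ∈ GH (n + 1)) : f g * dn f g c a = dn f g c a := by
  rw [dn, ← mul_assoc, ← mul_assoc, hf.idem hg]

theorem dn_mul (hf : IsModel f) {n : ℕ} {g c : Letter} {a : Anchor} (hg : g ∈ GH (n + 1))
    (he : IsEdge g c a) : dn f g c a * f c = dn f g c a := by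
  rw [dn, mul_assoc, hf.idem (he.mem hg)]

end IsModel

/-! ### `F_1^1` as a monoid -/

theorem cls_rel {u v : FreeSemigroup Gen} (h : Rel u v) : cls u = cls v :=
  (Con.eq _).2 (ConGen.Rel.of _ _ h)

theorem cls_mul (u v : FreeSemigroup Gen) : cls (u * v) = cls u * cls v := rfl

theorem cls_surjective : Function.Surjective cls := Quotient.mk_surjective

theorem cls_one_mul (u : FreeSemigroup Gen) : cls (wa .one) * cls u = cls u := by
  induction u with
  | ih1 g => exact cls_rel (Rel.one_mul g)
  | ih2 g v hg hv =>
    rw [cls_mul, ← mul_assoc]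
    exact congrArg (· * cls v) hg

theorem cls_mul_one (u : FreeSemigroup Gen) : cls u * cls (wa .one) = cls u := by
  induction u with
  | ih1 g => exact cls_rel (Rel.mul_one g)
  | ih2 g v hg hv => rw [cls_mul, mul_assoc, hv]

noncomputable instance : Monoid FOneOne where
  one := cls (wa .one)
  one_mul a := by
    obtain ⟨u, rfl⟩ := cls_surjective a
    exact cls_one_mul u
  mul_one a := by
    obtain ⟨u, rfl⟩ := cls_surjective a
    exact cls_mul_one u

theorem one_def : (1 : FOneOne) = cls (wa .one) := rfl

theorem eq_one_of_mul_eq_one {u v : FOneOne} (h : u * v = 1) : u = 1 ∧ v = 1 := by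
  obtain ⟨u, rfl⟩ := cls_surjective u
  obtain ⟨v, rfl⟩ := cls_surjective v
  rw [one_def, ← cls_mul, cls_eq_one_iff, map_mul] at h
  exact ⟨(cls_eq_one_iff u).2 (Nat.eq_one_of_mul_eq_one_right h),
    (cls_eq_one_iff v).2 (Nat.eq_one_of_mul_eq_one_left h)⟩

theorem mem_G_of_mem_GH {g : Letter} {n : ℕ} (h : g ∈ GH n) : g ∈ G := by
  cases n with
  | zero => exact Or.inl ⟨_, mem_GH_zero.1 h⟩
  | succ n => exact Or.inr ⟨n + 1, by omega, h⟩

open Classical in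
/-- The class of a letter (and `1` for tuples that are not generators). -/
noncomputable def el (g : Letter) : FOneOne := if h : g ∈ G then cls (w ⟨g, h⟩) else 1

theorem el_gen (g : Gen) : el g.1 = cls (w g) := by simp [el, g.2]

theorem el_anchor (a : Anchor) : el (anchor a) = cls (wa a) := el_gen (Gen.ofAnchor a)

theorem isModel_el : IsModel el where
  one := el_anchor _
  x_xinv_x := by simp only [el_anchor]; exact cls_rel .x_xinv_x
  xinv_x_xinv := by simp only [el_anchor]; exact cls_rel .xinv_x_xinv
  gxx_eq := by
    simp only [el_anchor]
    exact (el_gen Gen.gxx).trans (cls_rel .gxx_eq)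
  idem {n g} h := by
    rw [el_gen ⟨g, mem_G_of_mem_GH h⟩]
    exact cls_rel (.idem _ n h)
  left_absorb {n l la c ra r} h := by
    obtain ⟨h1, h2, h3⟩ := entries_mem h
    have := Rel.left_absorb ⟨_, mem_G_of_mem_GH h⟩ ⟨_, mem_G_of_mem_GH h1⟩ ⟨_, mem_G_of_mem_GH h2⟩
      ⟨_, mem_G_of_mem_GH h3⟩ la ra (n + 2) (by omega) h rfl
    have := cls_rel this
    simp only [cls_mul, ← el_gen] at this
    exact this
  right_absorb {n l la c ra r} h := by
    obtain ⟨h1, h2, h3⟩ := entries_mem h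
    have := Rel.right_absorb ⟨_, mem_G_of_mem_GH h⟩ ⟨_, mem_G_of_mem_GH h1⟩ ⟨_, mem_G_of_mem_GH h2⟩
      ⟨_, mem_G_of_mem_GH h3⟩ la ra (n + 2) (by omega) h rfl
    have := cls_rel this
    simp only [cls_mul, ← el_gen] at this
    exact this
  sandwich {n l la c ra r} h := by
    obtain ⟨h1, h2, h3⟩ := entries_mem h
    have := Rel.sandwich ⟨_, mem_G_of_mem_GH h⟩ ⟨_, mem_G_of_mem_GH h1⟩ ⟨_, mem_G_of_mem_GH h2⟩
      ⟨_, mem_G_of_mem_GH h3⟩ la ra (n + 2) (by omega) h rfl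
    have := cls_rel this
    simp only [cls_mul, ← el_gen] at this
    exact this

/-- Induction over products of letters. -/
theorem el_induction {p : FOneOne → Prop} (h1 : p 1)
    (hx : ∀ u, p u → p (u * el (anchor .x))) (hx' : ∀ u, p u → p (u * el (anchor .xinv)))
    (hg : ∀ u n, ∀ g ∈ GH n, p u → p (u * el g)) (u : FOneOne) : p u := by
  have hs : ∀ u (g : Gen), p u → p (u * cls (w g)) := by
    rintro u ⟨g, ⟨a, rfl⟩ | ⟨n, -, hgn⟩⟩ hu
    · rw [← el_gen]
      cases a with
      | one => rw [isModel_el.one, mul_one]; exact hu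
      | x => exact hx u hu
      | xinv => exact hx' u hu
    · rw [← el_gen]
      exact hg u n g hgn hu
  have key : ∀ v : FreeSemigroup Gen, ∀ u, p u → p (u * cls v) := by
    intro v
    induction v with
    | ih1 g => exact fun u => hs u g
    | ih2 g v hg hv =>
      intro u hu
      rw [cls_mul, ← mul_assoc]
      exact hv _ (hs u g hu)
  obtain ⟨u, rfl⟩ := cls_surjective u
  rw [← one_mul (cls u)]
  exact key u 1 h1

/-- The homomorphism given by a model. -/
theorem IsModel.exists_hom {N : Type*} [Monoid N] {f : Letter → N} (hf : IsModel f) :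
    ∃ F : FOneOne →* N, ∀ g : Gen, F (cls (w g)) = f g.1 := by
  let F₀ : FreeSemigroup Gen →ₙ* N := FreeSemigroup.lift fun g => f g.1
  have hw : ∀ g : Gen, F₀ (w g) = f g.1 := fun g => rfl
  have ha : ∀ a : Anchor, F₀ (wa a) = f (anchor a) := fun a => rfl
  have hrel : conGen Rel ≤ Con.ker F₀ := by
    refine Con.conGen_le.2 fun u v h => ?_
    change F₀ u = F₀ v
    cases h with
    | x_xinv_x => simp only [map_mul, ha, hf.x_xinv_x]
    | xinv_x_xinv => simp only [map_mul, ha, hf.xinv_x_xinv]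
    | gxx_eq => simp only [map_mul, ha]; exact hf.gxx_eq
    | one_mul g => rw [map_mul, ha, hf.one, _root_.one_mul]
    | mul_one g => rw [map_mul, ha, hf.one, _root_.mul_one]
    | idem g i hg => rw [map_mul, hw, hf.idem hg]
    | left_absorb g l c r la ra i hi hg he =>
      obtain ⟨j, rfl⟩ := Nat.exists_eq_add_of_le' hi
      rw [he] at hg
      simp only [map_mul, ha, hw, he, hf.left_absorb hg]
    | right_absorb g l c r la ra i hi hg he =>
      obtain ⟨j, rfl⟩ := Nat.exists_eq_add_of_le' hi
      rw [he] at hg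
      simp only [map_mul, ha, hw, he, hf.right_absorb hg]
    | sandwich g l c r la ra i hi hg he =>
      obtain ⟨j, rfl⟩ := Nat.exists_eq_add_of_le' hi
      rw [he] at hg
      simp only [map_mul, ha, hw, he, hf.sandwich hg]
  refine ⟨{ toFun := fun q => Con.liftOn q F₀ fun a b h => hrel h
            map_one' := hf.one
            map_mul' := ?_ }, fun g => rfl⟩
  intro a b
  obtain ⟨u, rfl⟩ := cls_surjective a
  obtain ⟨v, rfl⟩ := cls_surjective b
  exact map_mul F₀ u v

/-! ### A representation by partial maps on upward paths -/

/-- An edge from a letter to a lower letter, with its label. -/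
abbrev Edge : Type := Letter × Letter × Anchor

/-- The monoid of pointed maps on lists of edges in which the representation takes its values. -/
abbrev Rep : Type := Function.End (Option (List Edge))

/-- The letter that closes the valley of two edges. -/
def peak (e f : Edge) : Letter := tuple f.1 f.2.2.inv f.2.1 e.2.2.inv e.1

open Classical in
/-- Follow an edge downwards. -/
noncomputable def descend : Edge → List Edge → Option (List Edge)
  | _, [] => none
  | e, f :: p => if e = f then some p else
      (descend (peak e f, f.1, f.2.2.inv) p).map (List.cons (peak e f, e.1, e.2.2.inv))

/-- Extension of paths by an edge. -/
def repUp (e : Edge) : Rep := fun p => p.map (List.cons e)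

/-- Partial map that follows an edge downwards. -/
noncomputable def repDn (e : Edge) : Rep := fun p => p.bind (descend e)

theorem repDn_mul_repUp (e : Edge) : repDn e * repUp e = 1 := by
  funext p
  cases p with
  | none => rfl
  | some p =>
    change repDn e (repUp e (some p)) = some p
    simp [repDn, repUp, descend]

/-- This is the recursion of `descend`. It needs neither composable lists nor a common lower letter
of e and f, so the representation can ignore which lists are genuine paths. -/
theorem repDn_mul_repUp_of_ne {e f : Edge} (h : e ≠ f) :
    repDn e * repUp f =
      repUp (peak e f, e.1, e.2.2.inv) * repDn (peak e f, f.1, f.2.2.inv) := by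
  funext p
  cases p with
  | none => rfl
  | some p =>
    change repDn e (repUp f (some p)) = repUp _ (repDn _ (some p))
    simp [repDn, repUp, descend, h]

/-- The empty list has no edge to follow down, so it is sent to `none`. -/
theorem repUp_mul_repDn_ne_one (e : Edge) : repUp e * repDn e ≠ 1 := by
  intro h
  have : repUp e (repDn e (some [])) = some [] := congrFun h (some [])
  simp [repDn, repUp, descend] at this

open Classical in
/-- The upward path of a letter. -/
noncomputable def climb : Letter → Rep
  | anchor _ => 1
  -- Among the letters of positive height only `gxx` has centre x. Its climb is its left edge, whose
  -- upward value in F_1^1 is `gxx` itself.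
  | tuple l la c ra r => if c = anchor .x then repUp (gxx, anchor .one, .one) else
      climb c * repUp (l, c, la.inv) * repUp (tuple l la c ra r, l, la)

open Classical in
/-- The downward path of a letter. -/
noncomputable def fall : Letter → Rep
  | anchor _ => 1
  | tuple l la c ra r => if c = anchor .x then repDn (gxx, anchor .one, .one) else
      repDn (tuple l la c ra r, r, ra) * repDn (r, c, ra.inv) * fall c

/-- The value of a letter in the representation. -/
noncomputable def rep : Letter → Rep
  | anchor .one => 1
  | anchor .x => repUp (gxx, anchor .one, .one) * repDn (gxx, anchor .one, .xinv)
  | anchor .xinv => repUp (gxx, anchor .one, .xinv) * repDn (gxx, anchor .one, .one)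
  | tuple l la c ra r => climb (tuple l la c ra r) * fall (tuple l la c ra r)

theorem rep_of_mem {g : Letter} {n : ℕ} (h : g ∈ GH n) : rep g = climb g * fall g := by
  cases n with
  | zero => rw [mem_GH_zero.1 h]; rfl
  | succ n => obtain ⟨l, la, c, ra, r, rfl⟩ := exists_tuple h; rfl

theorem ne_anchor_x {g : Letter} {n : ℕ} (h : g ∈ GH n) : g ≠ anchor .x := by
  rintro rfl
  cases n with
  | zero => cases mem_GH_zero.1 h
  | succ n => exact anchor_notMem _ _ h

theorem climb_tuple {l c r : Letter} {la ra : Anchor} {n : ℕ}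
    (h : tuple l la c ra r ∈ GH (n + 2)) : climb (tuple l la c ra r) =
      climb c * repUp (l, c, la.inv) * repUp (tuple l la c ra r, l, la) := by
  rw [climb, if_neg (ne_anchor_x (entries_mem h).2.1)]

theorem fall_tuple {l c r : Letter} {la ra : Anchor} {n : ℕ}
    (h : tuple l la c ra r ∈ GH (n + 2)) : fall (tuple l la c ra r) =
      repDn (tuple l la c ra r, r, ra) * repDn (r, c, ra.inv) * fall c := by
  rw [fall, if_neg (ne_anchor_x (entries_mem h).2.1)]

theorem climb_gxx : climb gxx = repUp (gxx, anchor .one, .one) := by simp [gxx, climb]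

theorem fall_gxx : fall gxx = repDn (gxx, anchor .one, .one) := by simp [gxx, fall]

theorem repDn_mul_repUp_entries {l c r : Letter} {la ra : Anchor} {n : ℕ}
    (h : tuple l la c ra r ∈ GH (n + 2)) : repDn (r, c, ra.inv) * repUp (l, c, la.inv) =
      repUp (tuple l la c ra r, r, ra) * repDn (tuple l la c ra r, l, la) := by
  rw [repDn_mul_repUp_of_ne (edges_of_mem h).2.2]
  simp only [peak, Anchor.inv_inv]

/-- By induction the middle part at c cancels. The remaining valley from r through c to l turns into
the peak g, and both sides of that peak cancel. -/
theorem fall_mul_climb {g : Letter} {n : ℕ} (h : g ∈ GH n) : fall g * climb g = 1 := by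
  induction n using Nat.strong_induction_on generalizing g with
  | _ n ih =>
    match n, h with
    | 0, h => rw [mem_GH_zero.1 h]; rfl
    | 1, h => rw [mem_GH_one.1 h, climb_gxx, fall_gxx, repDn_mul_repUp]
    | n + 2, h =>
      obtain ⟨l, la, c, ra, r, rfl⟩ := exists_tuple h
      rw [climb_tuple h, fall_tuple h]
      set g := tuple l la c ra r with hg
      calc _ = repDn (g, r, ra) * repDn (r, c, ra.inv) * (fall c * climb c) *
              repUp (l, c, la.inv) * repUp (g, l, la) := by simp only [mul_assoc]
        _ = repDn (g, r, ra) * (repDn (r, c, ra.inv) * repUp (l, c, la.inv)) *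
              repUp (g, l, la) := by
            rw [ih n (by omega) (entries_mem h).2.1, mul_one, mul_assoc (repDn (g, r, ra))]
        _ = (repDn (g, r, ra) * repUp (g, r, ra)) * (repDn (g, l, la) * repUp (g, l, la)) := by
            rw [repDn_mul_repUp_entries h]
            simp only [mul_assoc, ← hg]
        _ = 1 := by simp only [repDn_mul_repUp, mul_one]

/-- Stripped of the climbs and falls of its ends, an edge value becomes the elementary operator of
that edge. This reduces the defining relations for `rep` to the rules for `repUp` and `repDn`. -/
theorem fall_mul_rep_mul_climb {g c : Letter} {a : Anchor} {n : ℕ} (h : g ∈ GH (n + 1))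
    (he : IsEdge g c a) : fall c * rep (anchor a) * climb g = repUp (g, c, a) ∧
      fall g * rep (anchor a.inv) * climb c = repDn (g, c, a) := by
  induction n generalizing g c a with
  | zero =>
    rw [mem_GH_one] at h
    subst h
    rcases he with he | he <;> cases he <;> rw [climb_gxx, fall_gxx]
    · exact ⟨rfl, rfl⟩
    · constructor
      · change 1 * (repUp (gxx, anchor .one, .xinv) * repDn (gxx, anchor .one, .one)) *
          repUp (gxx, anchor .one, .one) = repUp (gxx, anchor .one, .xinv)
        rw [one_mul, mul_assoc, repDn_mul_repUp, mul_one]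
      · change repDn (gxx, anchor .one, .one) * (repUp (gxx, anchor .one, .one) *
          repDn (gxx, anchor .one, .xinv)) * 1 = repDn (gxx, anchor .one, .xinv)
        rw [mul_one, ← mul_assoc, repDn_mul_repUp, one_mul]
  | succ n ih =>
    obtain ⟨l, la, d, ra, r, rfl⟩ := exists_tuple h
    obtain ⟨hl, hd, hr⟩ := entries_mem h
    obtain ⟨el, er, -⟩ := edges_of_mem h
    obtain ⟨l1, l2⟩ := ih hl el
    obtain ⟨r1, r2⟩ := ih hr er
    have hk := repDn_mul_repUp_entries h
    rw [Anchor.inv_inv] at l2 r2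
    rw [climb_tuple h, fall_tuple h]
    set g := tuple l la d ra r with hg
    rcases he with he | he <;> obtain ⟨h1, h2⟩ := Prod.mk.inj he <;>
      simp only [hg, left, right, leftAnchor, rightAnchor] at h1 h2 <;> rw [h1, h2]
    · constructor
      · calc _ = (fall l * rep (anchor la) * climb d) * repUp (l, d, la.inv) * repUp (g, l, la) := by
              simp only [mul_assoc]
          _ = _ := by rw [l2, repDn_mul_repUp, one_mul]
      · calc _ = repDn (g, r, ra) * repDn (r, d, ra.inv) *
                (fall d * rep (anchor la.inv) * climb l) := by simp only [mul_assoc]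
          _ = _ := by rw [l1, mul_assoc, hk, ← mul_assoc, repDn_mul_repUp, one_mul]
    · constructor
      · calc _ = (fall r * rep (anchor ra) * climb d) * repUp (l, d, la.inv) * repUp (g, l, la) := by
              simp only [mul_assoc]
          _ = _ := by rw [r2, hk, mul_assoc, repDn_mul_repUp, mul_one]
      · calc _ = repDn (g, r, ra) * repDn (r, d, ra.inv) *
                (fall d * rep (anchor ra.inv) * climb r) := by simp only [mul_assoc]
          _ = _ := by rw [r1, mul_assoc, repDn_mul_repUp, mul_one]

theorem up_rep {g c : Letter} {a : Anchor} {n : ℕ} (h : g ∈ GH (n + 1))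
    (he : IsEdge g c a) : up rep g c a = climb c * repUp (g, c, a) * fall g := by
  rw [up, rep_of_mem h, rep_of_mem (he.mem h), ← (fall_mul_rep_mul_climb h he).1]
  simp only [mul_assoc]

theorem dn_rep {g c : Letter} {a : Anchor} {n : ℕ} (h : g ∈ GH (n + 1))
    (he : IsEdge g c a) : dn rep g c a = climb g * repDn (g, c, a) * fall c := by
  rw [dn, rep_of_mem h, rep_of_mem (he.mem h), ← (fall_mul_rep_mul_climb h he).2]
  simp only [mul_assoc]

theorem rep_idem {g : Letter} {n : ℕ} (h : g ∈ GH n) : rep g * rep g = rep g := by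
  rw [rep_of_mem h, mul_assoc, ← mul_assoc (fall g), fall_mul_climb h, one_mul]

theorem isModel_rep : IsModel rep where
  one := rfl
  x_xinv_x := by
    simp only [rep, mul_assoc]
    rw [← mul_assoc (repDn _) (repUp _), repDn_mul_repUp, one_mul,
      ← mul_assoc (repDn _) (repUp _), repDn_mul_repUp, one_mul]
  xinv_x_xinv := by
    simp only [rep, mul_assoc]
    rw [← mul_assoc (repDn _) (repUp _), repDn_mul_repUp, one_mul,
      ← mul_assoc (repDn _) (repUp _), repDn_mul_repUp, one_mul]
  gxx_eq := by
    rw [rep_of_mem (mem_GH_one.2 rfl), climb_gxx, fall_gxx]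
    simp only [rep, mul_assoc]
    rw [← mul_assoc (repDn _) (repUp _), repDn_mul_repUp, one_mul]
  idem := rep_idem
  left_absorb {n l la c ra r} h := by
    obtain ⟨hl, hc, hr⟩ := entries_mem h
    have h1 := (fall_mul_rep_mul_climb hl (edges_of_mem h).1).1
    have h2 := (fall_mul_rep_mul_climb h (Or.inl rfl)).1
    simp only [left, leftAnchor] at h2
    rw [rep_of_mem h, rep_of_mem hc, rep_of_mem hl]
    calc _ = climb c * (fall c * rep (anchor la.inv) * climb l) *
          (fall l * rep (anchor la) * climb (tuple l la c ra r)) * fall (tuple l la c ra r) := by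
          simp only [mul_assoc]
      _ = _ := by rw [h1, h2, climb_tuple h]
  right_absorb {n l la c ra r} h := by
    obtain ⟨hl, hc, hr⟩ := entries_mem h
    have h1 := (fall_mul_rep_mul_climb hr (edges_of_mem h).2.1).2
    have h2 := (fall_mul_rep_mul_climb h (Or.inr rfl)).2
    simp only [right, rightAnchor, Anchor.inv_inv] at h1 h2
    rw [rep_of_mem h, rep_of_mem hc, rep_of_mem hr]
    calc _ = climb (tuple l la c ra r) * (fall (tuple l la c ra r) * rep (anchor ra.inv) * climb r) *
          (fall r * rep (anchor ra) * climb c) * fall c := by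
          simp only [mul_assoc]
      _ = _ := by rw [h1, h2, fall_tuple h]; simp only [mul_assoc]
  sandwich {n l la c ra r} h := by
    obtain ⟨hl, hc, hr⟩ := entries_mem h
    have h1 := (fall_mul_rep_mul_climb hl (edges_of_mem h).1).1
    have h2 := (fall_mul_rep_mul_climb hr (edges_of_mem h).2.1).2
    have h3 := (fall_mul_rep_mul_climb h (Or.inr rfl)).1
    have h4 := (fall_mul_rep_mul_climb h (Or.inl rfl)).2
    simp only [left, leftAnchor, right, rightAnchor, Anchor.inv_inv] at h2 h3 h4
    rw [rep_of_mem h, rep_of_mem hc, rep_of_mem hr, rep_of_mem hl]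
    calc _ = climb r * (fall r * rep (anchor ra) * climb (tuple l la c ra r)) *
          (fall (tuple l la c ra r) * rep (anchor la.inv) * climb l) * fall l := by
          simp only [mul_assoc]
      _ = climb r * (fall r * rep (anchor ra) * climb c) *
          (fall c * rep (anchor la.inv) * climb l) * fall l := by
          rw [h1, h2, h3, h4, mul_assoc (climb r), mul_assoc (climb r), ← repDn_mul_repUp_entries h]
          simp only [mul_assoc]
      _ = _ := by simp only [mul_assoc]

/-- Climbing an edge and going back is not trivial. -/
theorem up_mul_dn_ne {g c : Letter} {a : Anchor} {n : ℕ} (h : g ∈ GH (n + 1))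
    (he : IsEdge g c a) : up el g c a * dn el g c a ≠ el c := by
  intro heq
  obtain ⟨F, hF⟩ := isModel_rep.exists_hom
  have hG : ∀ k : Letter, k ∈ G → F (el k) = rep k := fun k hk => by
    rw [el_gen ⟨k, hk⟩, hF]
  have ha : ∀ b : Anchor, F (el (anchor b)) = rep (anchor b) := fun b => hG _ (Or.inl ⟨b, rfl⟩)
  have hg := hG g (mem_G_of_mem_GH h)
  have hc := hG c (mem_G_of_mem_GH (he.mem h))
  have h1 : F (up el g c a) = up rep g c a := by simp only [up, map_mul, hg, hc, ha]
  have h2 : F (dn el g c a) = dn rep g c a := by simp only [dn, map_mul, hg, hc, ha]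
  have h3 := congrArg F heq
  rw [map_mul, h1, h2, up_rep h he, dn_rep h he, hc, rep_of_mem (he.mem h)] at h3
  have h4 := fall_mul_climb (he.mem h)
  have h5 := fall_mul_climb h
  -- Conjugating the assumed equality by `fall c` and `climb c` isolates the elementary operators.
  apply repUp_mul_repDn_ne_one (g, c, a)
  calc _ = (fall c * climb c) * repUp (g, c, a) * (fall g * climb g) * repDn (g, c, a) *
        (fall c * climb c) := by rw [h4, h5]; simp only [one_mul, mul_one]
    _ = fall c * (climb c * repUp (g, c, a) * fall g * (climb g * repDn (g, c, a) * fall c)) *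
        climb c := by simp only [mul_assoc]
    _ = (fall c * climb c) * (fall c * climb c) := by rw [h3]; simp only [mul_assoc]
    _ = 1 := by rw [h4, one_mul]

/-! ### Every element is an upward path followed by a downward path -/

/-- `Upward v h m`: some upward path from the letter `v` to the letter `h` has the value `m`. -/
inductive Upward (v : Letter) : Letter → FOneOne → Prop
  | refl : Upward v v (el v)
  | snoc {h g : Letter} {a : Anchor} {m : FOneOne} {n : ℕ} (hm : Upward v h m)
      (hg : g ∈ GH (n + 1)) (he : IsEdge g h a) : Upward v g (m * up el g h a)

/-- `Downward h w m`: some downward path from the letter `h` to the letter `w` has the value `m`. -/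
inductive Downward (h : Letter) : Letter → FOneOne → Prop
  | refl : Downward h h (el h)
  | snoc {w c : Letter} {a : Anchor} {m : FOneOne} {n : ℕ} (hm : Downward h w m)
      (hw : w ∈ GH (n + 1)) (he : IsEdge w c a) : Downward h c (m * dn el w c a)

/-- `UpDown v w z`: the element `z` is the value of a path from `v` to `w` that first goes up and
then goes down. -/
def UpDown (v w : Letter) (z : FOneOne) : Prop :=
  ∃ h α β, Upward v h α ∧ Downward h w β ∧ z = α * β

theorem Upward.mem {v h : Letter} {m : FOneOne} {n : ℕ} (H : Upward v h m) (hv : v ∈ GH n) :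
    ∃ k, h ∈ GH (n + k) := by
  induction H with
  | refl => exact ⟨0, hv⟩
  | snoc hm hg he ih =>
    obtain ⟨k, hk⟩ := ih
    have e1 := height_of_mem hk
    have e2 := height_of_mem (he.mem hg)
    rw [show _ = n + k from e2.symm.trans e1] at hg
    exact ⟨k + 1, hg⟩

theorem Downward.mem {h w : Letter} {m : FOneOne} {n : ℕ} (H : Downward h w m) (hh : h ∈ GH n) :
    ∃ j, w ∈ GH j ∧ j ≤ n := by
  induction H with
  | refl => exact ⟨n, hh, le_rfl⟩
  | snoc hm hw he ih =>
    obtain ⟨j, hj, hjn⟩ := ih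
    have e1 := height_of_mem hj
    have e2 := height_of_mem hw
    exact ⟨_, he.mem hw, by omega⟩

theorem Upward.mul_right {v h : Letter} {m : FOneOne} {n : ℕ} (H : Upward v h m) (hv : v ∈ GH n) :
    m * el h = m := by
  cases H with
  | refl => exact isModel_el.idem hv
  | snoc hm hg he => rw [mul_assoc, isModel_el.up_mul _ _ hg]

theorem Downward.mul_right {h w : Letter} {m : FOneOne} {n : ℕ} (H : Downward h w m)
    (hh : h ∈ GH n) : m * el w = m := by
  cases H with
  | refl => exact isModel_el.idem hh
  | snoc hm hw he => rw [mul_assoc, isModel_el.dn_mul hw he]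

theorem Downward.mul_left {h w : Letter} {m : FOneOne} {n : ℕ} (H : Downward h w m)
    (hh : h ∈ GH n) : el h * m = m := by
  induction H with
  | refl => exact isModel_el.idem hh
  | snoc hm hw he ih => rw [← mul_assoc, ih]

theorem UpDown.mul_dn {v w c : Letter} {a : Anchor} {z : FOneOne} {n : ℕ} (H : UpDown v w z)
    (hw : w ∈ GH (n + 1)) (he : IsEdge w c a) : UpDown v c (z * dn el w c a) := by
  obtain ⟨h, α, β, hα, hβ, rfl⟩ := H
  exact ⟨h, α, _, hα, hβ.snoc hw he, mul_assoc _ _ _⟩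

/-- Induction on the downward path. If its last edge is the new one, the two cancel. Otherwise their
valley becomes a peak, and the shorter path is extended by the edge up to that peak, followed by one
edge down. -/
theorem Downward.upDown_mul_up {v h w g : Letter} {a : Anchor} {α β : FOneOne} {m n : ℕ}
    (hβ : Downward h w β) (hv : v ∈ GH m) (hα : Upward v h α) (hg : g ∈ GH (n + 1))
    (he : IsEdge g w a) : UpDown v g (α * β * up el g w a) := by
  induction hβ generalizing g a n with
  | refl =>
    refine ⟨g, _, _, hα.snoc hg he, .refl, ?_⟩
    rw [hα.mul_right hv, mul_assoc, isModel_el.up_mul _ _ hg]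
  | @snoc w c b β k hβ hw hb ih =>
    obtain rfl : k = n := by
      have e1 := height_of_mem (hb.mem hw)
      have e2 := height_of_mem (he.mem hg)
      omega
    by_cases heq : (w, c, b) = (g, c, a)
    · cases heq
      obtain ⟨j, hj⟩ := hα.mem hv
      refine ⟨h, α, β, hα, hβ, ?_⟩
      rw [mul_assoc, mul_assoc, isModel_el.dn_mul_up hw hb, hβ.mul_right hj]
    · have hk := valley_mem hg hw he hb heq
      have h1 := ih hk (Or.inr rfl : IsEdge (tuple g a.inv c b.inv w) w b.inv)
      have h2 := h1.mul_dn hk (Or.inl rfl : IsEdge (tuple g a.inv c b.inv w) g a.inv)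
      convert h2 using 1
      rw [mul_assoc, mul_assoc, isModel_el.dn_mul_up_of_ne hg hw he hb heq]
      simp only [mul_assoc]

theorem UpDown.mul_up {v w g : Letter} {a : Anchor} {z : FOneOne} {m n : ℕ} (H : UpDown v w z)
    (hv : v ∈ GH m) (hg : g ∈ GH (n + 1)) (he : IsEdge g w a) : UpDown v g (z * up el g w a) := by
  obtain ⟨h, α, β, hα, hβ, rfl⟩ := H
  exact hβ.upDown_mul_up hv hα hg he

theorem isEdge_gxx_left : IsEdge gxx (anchor .one) .one := Or.inl rfl

theorem isEdge_gxx_right : IsEdge gxx (anchor .one) .xinv := Or.inr rfl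

theorem gxx_mem : gxx ∈ GH 1 := mem_GH_one.2 rfl

theorem one_mem : anchor .one ∈ GH 0 := mem_GH_zero.2 rfl

theorem el_one : el (anchor .one) = 1 := isModel_el.one

theorem up_gxx_left : up el gxx (anchor .one) .one = el gxx := by
  simp [up, el_one]

theorem dn_gxx_left : dn el gxx (anchor .one) .one = el gxx := by
  simp [dn, el_one, Anchor.inv]

/-- The two directions of the right edge of `gxx` are the generators x' and x, so these too act by
paths. -/
theorem up_gxx_right : up el gxx (anchor .one) .xinv = el (anchor .xinv) := by
  rw [up, el_one, one_mul, isModel_el.gxx_eq, ← mul_assoc, isModel_el.xinv_x_xinv]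

theorem dn_gxx_right : dn el gxx (anchor .one) .xinv = el (anchor .x) := by
  rw [dn, el_one, mul_one, isModel_el.gxx_eq, Anchor.inv, isModel_el.x_xinv_x]

/-- Left absorption rewrites g as the climb from c to l to g, preceded by c, which is reached by
induction. `UpDown.mul_fall` is the dual. -/
theorem UpDown.mul_climb {v s : Letter} {z : FOneOne} {m n : ℕ} (H : UpDown v (anchor .one) z)
    (hv : v ∈ GH m) (hs : s ∈ GH n) : UpDown v s (z * el s) := by
  induction n using Nat.strong_induction_on generalizing s with
  | _ n ih =>
    match n, hs with
    | 0, hs => rw [mem_GH_zero.1 hs, el_one, mul_one]; exact H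
    | 1, hs =>
      have := H.mul_up hv gxx_mem isEdge_gxx_left
      rwa [mem_GH_one.1 hs, ← up_gxx_left]
    | n + 2, hs =>
      obtain ⟨l, la, c, ra, r, rfl⟩ := exists_tuple hs
      obtain ⟨hl, hc, -⟩ := entries_mem hs
      have h1 := ((ih n (by omega) hc).mul_up hv hl (edges_of_mem hs).1).mul_up hv hs (Or.inl rfl)
      convert h1 using 1
      conv_lhs => rw [← isModel_el.left_absorb hs]
      simp only [up, leftAnchor]
      rw [mul_assoc z, mul_assoc z]
      congr 1
      calc _ = (el c * el c) * el (anchor la.inv) * (el l * el l) * el (anchor la) *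
            el (tuple l la c ra r) := by
            rw [isModel_el.idem hc, isModel_el.idem hl]; simp only [mul_assoc]
        _ = _ := by simp only [mul_assoc]

theorem UpDown.mul_fall {v s : Letter} {z : FOneOne} {n : ℕ} (H : UpDown v s z)
    (hs : s ∈ GH n) : UpDown v (anchor .one) (z * el s) := by
  induction n using Nat.strong_induction_on generalizing s z with
  | _ n ih =>
    match n, hs with
    | 0, hs => rw [mem_GH_zero] at hs; subst hs; rw [el_one, mul_one]; exact H
    | 1, hs =>
      rw [mem_GH_one] at hs
      subst hs
      have := H.mul_dn gxx_mem isEdge_gxx_left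
      rwa [dn_gxx_left] at this
    | n + 2, hs =>
      obtain ⟨l, la, c, ra, r, rfl⟩ := exists_tuple hs
      obtain ⟨-, hc, hr⟩ := entries_mem hs
      have h1 := ih n (by omega) ((H.mul_dn hs (Or.inr rfl)).mul_dn hr (edges_of_mem hs).2.1) hc
      convert h1 using 1
      conv_lhs => rw [← isModel_el.right_absorb hs]
      simp only [dn, right, rightAnchor, Anchor.inv_inv]
      rw [mul_assoc z, mul_assoc z]
      congr 1
      calc _ = el (tuple l la c ra r) * el (anchor ra.inv) * (el r * el r) * el (anchor ra) *
            (el c * el c) := by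
            rw [isModel_el.idem hc, isModel_el.idem hr]; simp only [mul_assoc]
        _ = _ := by simp only [mul_assoc]

theorem UpDown.mul {v : Letter} {z : FOneOne} {m : ℕ} (H : UpDown v (anchor .one) z)
    (hv : v ∈ GH m) (u : FOneOne) : UpDown v (anchor .one) (z * u) := by
  induction u using el_induction with
  | h1 => rwa [mul_one]
  | hx u ih =>
    have h1 := (ih.mul_up hv gxx_mem isEdge_gxx_left).mul_dn gxx_mem isEdge_gxx_right
    rw [dn_gxx_right, up_gxx_left, isModel_el.gxx_eq] at h1
    convert h1 using 1
    simp only [mul_assoc]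
    rw [← mul_assoc (el (anchor .x)) (el (anchor .xinv)), isModel_el.x_xinv_x]
  | hx' u ih =>
    have h1 := (ih.mul_up hv gxx_mem isEdge_gxx_right).mul_dn gxx_mem isEdge_gxx_left
    rw [dn_gxx_left, up_gxx_right, isModel_el.gxx_eq] at h1
    convert h1 using 1
    simp only [mul_assoc]
    rw [← mul_assoc (el (anchor .xinv)) (el (anchor .x)), isModel_el.xinv_x_xinv]
  | hg u n g hg ih =>
    -- Since g is idempotent, it can be used once to climb and once to fall.
    have h1 := (ih.mul_climb hv hg).mul_fall hg
    rwa [mul_assoc, isModel_el.idem hg, mul_assoc] at h1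

theorem upDown_of_mul_eq {v c : Letter} {z : FOneOne} {m n : ℕ} (hv : v ∈ GH m) (hc : c ∈ GH n)
    (h1 : el v * z = z) (h2 : z * el c = z) : UpDown v c z := by
  have h3 : UpDown v v (el v) := ⟨v, _, _, .refl, .refl, (isModel_el.idem hv).symm⟩
  have h4 := ((h3.mul_fall hv).mul hv z).mul_climb hv hc
  rwa [isModel_el.idem hv, h1, h2] at h4

/-! ### Regularity -/

theorem Upward.exists_left_inverse {v h : Letter} {m : FOneOne} {n : ℕ} (H : Upward v h m)
    (hv : v ∈ GH n) : ∃ m', m' * m = el h := by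
  induction H with
  | refl => exact ⟨el v, isModel_el.idem hv⟩
  | @snoc h g a m k hm hg he ih =>
    obtain ⟨m', hm'⟩ := ih
    refine ⟨dn el g h a * m', ?_⟩
    rw [mul_assoc, ← mul_assoc m', hm', isModel_el.mul_up hg he, isModel_el.dn_mul_up hg he]

theorem Downward.exists_right_inverse {h w : Letter} {m : FOneOne} {n : ℕ} (H : Downward h w m)
    (hh : h ∈ GH n) : ∃ m', m * m' = el h := by
  induction H with
  | refl => exact ⟨el h, isModel_el.idem hh⟩
  | @snoc w c a m k hm hw he ih =>
    obtain ⟨m', hm'⟩ := ih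
    refine ⟨up el w c a * m', ?_⟩
    rw [mul_assoc, ← mul_assoc (dn el w c a), isModel_el.dn_mul_up hw he, ← mul_assoc,
      hm.mul_right hh, hm']

/-- In the normal form αβ, the upward part has a left inverse and the downward part a right inverse,
both relative to the summit idempotent. -/
theorem exists_mul_mul_eq (z : FOneOne) : ∃ b, z * b * z = z := by
  obtain ⟨h, α, β, hα, hβ, rfl⟩ :=
    upDown_of_mul_eq (z := z) one_mem one_mem (by simp [el_one]) (by simp [el_one])
  obtain ⟨k, hk⟩ := hα.mem one_mem
  obtain ⟨α', h1⟩ := hα.exists_left_inverse one_mem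
  obtain ⟨β', h2⟩ := hβ.exists_right_inverse hk
  refine ⟨β' * α', ?_⟩
  calc _ = α * (β * β') * (α' * α) * β := by simp only [mul_assoc]
    _ = α * β := by rw [h1, h2, hα.mul_right one_mem, hα.mul_right one_mem]

theorem isRegular_F1 : IsRegularSemigroup F1 := by
  rintro ⟨z, hz⟩
  obtain ⟨b, hb⟩ := exists_mul_mul_eq z
  -- The element b itself might be 1; b z b is not, since z is not.
  refine ⟨⟨b * z * b, fun h => hz (eq_one_of_mul_eq_one (eq_one_of_mul_eq_one h).1).2⟩, ?_⟩
  apply Subtype.ext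
  change z * (b * z * b) * z = z
  calc _ = z * b * z * b * z := by simp only [mul_assoc]
    _ = z := by rw [hb, hb]

/-! ### Uniqueness of the inverses of edges -/

theorem Upward.cases_head {v h : Letter} {m : FOneOne} {n : ℕ} (H : Upward v h m)
    (hv : v ∈ GH n) : (h = v ∧ m = el v) ∨
      ∃ g a m' k, g ∈ GH (k + 1) ∧ IsEdge g v a ∧ m = up el g v a * m' := by
  induction H with
  | refl => exact Or.inl ⟨rfl, rfl⟩
  | @snoc h g a m k hm hg he ih =>
    right
    rcases ih with ⟨rfl, rfl⟩ | ⟨g', a', m', k', hg', he', rfl⟩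
    · exact ⟨g, a, 1, k, hg, he, by rw [isModel_el.mul_up hg he, mul_one]⟩
    · exact ⟨g', a', _, k', hg', he', mul_assoc _ _ _⟩

/-- Distinct edges below a letter do not cancel. -/
theorem dn_mul_up_ne {v c : Letter} {a b : Anchor} {n : ℕ} (hv : v ∈ GH (n + 1))
    (ha : IsEdge v c a) (hb : IsEdge v c b) (hab : a ≠ b) :
    dn el v c a * up el v c b ≠ el v := by
  intro h
  have hne : (v, c, a) ≠ (v, c, b) := fun h => hab (by cases h; rfl)
  have hk := valley_mem hv hv hb ha hne
  rw [isModel_el.dn_mul_up_of_ne hv hv hb ha hne] at h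
  -- The valley is a peak over v on both sides. If its value were v, multiplying by it would show
  -- that going up and down its left edge alone is already v.
  have e1 : IsEdge (tuple v b.inv c a.inv v) v b.inv := Or.inl rfl
  apply up_mul_dn_ne hk e1
  rw [← isModel_el.mul_up hk e1]
  nth_rewrite 1 [← h]
  rw [mul_assoc, mul_assoc, ← mul_assoc (dn _ _ _ _) (up _ _ _ _), isModel_el.dn_mul_up hk e1,
    isModel_el.mul_dn _ _ hk, h]

/-- If the normal form of z began with an upward edge, that edge would have a right inverse and
going up and down it would be trivial. So z is a downward path; its height drop is one, so it is a
single edge, and a wrong label is excluded by `dn_mul_up_ne`. The dual argument gives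
`eq_up_of_dn_mul`. -/
theorem eq_dn_of_mul_up {v c : Letter} {a : Anchor} {z : FOneOne} {n : ℕ} (hv : v ∈ GH (n + 1))
    (he : IsEdge v c a) (h1 : el v * z = z) (h2 : z * el c = z) (h : z * up el v c a = el v) :
    z = dn el v c a := by
  obtain ⟨h', α, β, hα, hβ, rfl⟩ := upDown_of_mul_eq hv (he.mem hv) h1 h2
  rcases hα.cases_head hv with ⟨rfl, rfl⟩ | ⟨g, b, m, k, hg, hb, rfl⟩
  · rw [hβ.mul_left hv] at h ⊢
    have hc := height_of_mem (he.mem hv)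
    have hv' := height_of_mem hv
    cases hβ with
    | refl => omega
    | @snoc w _ b β k hβ hw hb =>
      have hw' := height_of_mem hw
      have hc' := height_of_mem (hb.mem hw)
      cases hβ with
      | refl =>
        by_cases hab : b = a
        · rw [hab, isModel_el.mul_dn _ _ hv]
        · rw [isModel_el.mul_dn _ _ hv] at h
          exact (dn_mul_up_ne hv hb he hab h).elim
      | @snoc w' _ b' β k' hβ hw1 hb1 =>
        obtain ⟨j, hj, hjn⟩ := hβ.mem hv
        have e1 := height_of_mem hj
        have e2 := height_of_mem hw1
        have e3 := height_of_mem (hb1.mem hw1)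
        omega
  · exfalso
    apply up_mul_dn_ne hg hb
    have h3 : up el g v b * (m * β * up el v c a) = el v := by rw [← h]; simp only [mul_assoc]
    calc _ = up el g v b * dn el g v b * el v := by rw [mul_assoc, isModel_el.dn_mul hg hb]
      _ = up el g v b * (dn el g v b * up el g v b) * (m * β * up el v c a) := by
        rw [← h3]; simp only [mul_assoc]
      _ = el v := by rw [isModel_el.dn_mul_up hg hb, isModel_el.up_mul _ _ hg, h3]

theorem eq_up_of_dn_mul {v c : Letter} {a : Anchor} {z : FOneOne} {n : ℕ} (hv : v ∈ GH (n + 1))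
    (he : IsEdge v c a) (h1 : el c * z = z) (h2 : z * el v = z) (h : dn el v c a * z = el v) :
    z = up el v c a := by
  obtain ⟨h', α, β, hα, hβ, rfl⟩ := upDown_of_mul_eq (he.mem hv) hv h1 h2
  obtain ⟨j, hj⟩ := hα.mem (he.mem hv)
  cases hβ with
  | refl =>
    rw [hα.mul_right (he.mem hv)] at h ⊢
    have hc := height_of_mem (he.mem hv)
    have hv' := height_of_mem hv
    cases hα with
    | refl => omega
    | @snoc w _ b α k hα hw hb =>
      have hw' := height_of_mem hw
      have hc' := height_of_mem (hb.mem hw)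
      cases hα with
      | refl =>
        rw [isModel_el.mul_up hv hb] at h ⊢
        by_cases hab : b = a
        · rw [hab]
        · exact (dn_mul_up_ne hv he hb (Ne.symm hab) h).elim
      | @snoc w' _ b' α k' hα hw1 hb1 =>
        obtain ⟨i, hi⟩ := hα.mem (he.mem hv)
        have e1 := height_of_mem hi
        have e2 := height_of_mem hw1
        have e3 := height_of_mem (hb1.mem hw1)
        omega
  | @snoc g _ b β k hβ hg hb =>
    exfalso
    apply up_mul_dn_ne hg hb
    have h3 : (dn el v c a * α * β) * dn el g v b = el v := by rw [← h]; simp only [mul_assoc]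
    calc _ = el v * (up el g v b * dn el g v b) := by rw [← mul_assoc, isModel_el.mul_up hg hb]
      _ = (dn el v c a * α * β) * ((dn el g v b * up el g v b) * dn el g v b) := by
        rw [← h3]; simp only [mul_assoc]
      _ = el v := by rw [isModel_el.dn_mul_up hg hb, isModel_el.mul_dn _ _ hg, h3]

/-! ### Rigidity -/

/-- The image u of g satisfies the same relations as g over the same entries. Put y = l la u ra' r
and θ = r ra c la' l. Then y is an inverse of θ, and θ goes up from r to g and down to l. Uniqueness
of inverses of edges turns y = yθy into the path from l up to g and down to r, so y does not depend
on u; absorption recovers u from y. -/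
theorem map_el_eq_of_entries {F : FOneOne →* FOneOne}
    (ha : ∀ a, F (el (anchor a)) = el (anchor a)) {l c r : Letter} {la ra : Anchor} {n : ℕ}
    (hg : tuple l la c ra r ∈ GH (n + 2)) (hl : F (el l) = el l) (hc : F (el c) = el c)
    (hr : F (el r) = el r) : F (el (tuple l la c ra r)) = el (tuple l la c ra r) := by
  obtain ⟨hl', hc', hr'⟩ := entries_mem hg
  have u1 := congrArg F (isModel_el.left_absorb hg)
  have u2 := congrArg F (isModel_el.right_absorb hg)
  have u3 := congrArg F (isModel_el.sandwich hg)
  have u4 := congrArg F (isModel_el.idem hg)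
  have g1 := isModel_el.left_absorb hg
  have g2 := isModel_el.right_absorb hg
  have g3 := isModel_el.sandwich hg
  have g4 := isModel_el.idem hg
  have il := isModel_el.idem hl'
  have ic := isModel_el.idem hc'
  have ir := isModel_el.idem hr'
  simp only [map_mul, ha, hl, hc, hr] at u1 u2 u3 u4
  have eL : IsEdge (tuple l la c ra r) l la := Or.inl rfl
  have eR : IsEdge (tuple l la c ra r) r ra := Or.inr rfl
  generalize hu : F (el (tuple l la c ra r)) = u at u1 u2 u3 u4 ⊢
  set g := tuple l la c ra r with hgdef
  set y := el l * el (anchor la) * u * el (anchor ra.inv) * el r with hy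
  set θ := el r * el (anchor ra) * el c * el (anchor la.inv) * el l with hθ
  have hθ' : up el g r ra * dn el g l la = θ := by
    calc _ = el r * el (anchor ra) * (el g * el g) * el (anchor la.inv) * el l := by
          simp only [up, dn, mul_assoc]
      _ = θ := by rw [g4, g3]
  have h1 : θ * y * θ = θ := by
    calc _ = el r * el (anchor ra) * (el c * (el (anchor la.inv) * (el l * el l) * el (anchor la)) *
            u) * (el (anchor ra.inv) * (el r * el r) * el (anchor ra)) * el c *
            el (anchor la.inv) * el l := by simp only [hθ, hy, mul_assoc]
      _ = el r * el (anchor ra) * (u * (el (anchor ra.inv) * el r * el (anchor ra)) * el c) *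
            el (anchor la.inv) * el l := by rw [il, ir, u1]; simp only [mul_assoc]
      _ = θ := by rw [u2, u3]
  have h2 : y * θ * y = y := by
    calc _ = el l * el (anchor la) * (u * (el (anchor ra.inv) * (el r * el r) * el (anchor ra)) *
            el c) * (el (anchor la.inv) * (el l * el l) * el (anchor la)) *
            u * el (anchor ra.inv) * el r := by simp only [hθ, hy, mul_assoc]
      _ = el l * el (anchor la) * (u * (el (anchor ra.inv) * el r * el (anchor ra)) * el c) *
            (el c * (el (anchor la.inv) * el l * el (anchor la)) * u) * el (anchor ra.inv) *
            el r := by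
          nth_rewrite 1 [il, ir, ← ic]
          simp only [mul_assoc]
      _ = y := by rw [u1, u2, mul_assoc _ u u, u4]
  have dL := isModel_el.dn_mul_up hg eL
  have dR := isModel_el.dn_mul_up hg eR
  have h3 : dn el g l la * y * up el g r ra = el g := by
    calc _ = el g * dn el g l la * y * (up el g r ra * el g) := by
          rw [isModel_el.mul_dn _ _ hg, isModel_el.up_mul _ _ hg]
      _ = dn el g r ra * ((up el g r ra * dn el g l la) * y * (up el g r ra * dn el g l la)) *
            up el g l la := by
          calc _ = (dn el g r ra * up el g r ra) * dn el g l la * y *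
                (up el g r ra * (dn el g l la * up el g l la)) := by rw [dL, dR]
            _ = _ := by simp only [mul_assoc]
      _ = (dn el g r ra * up el g r ra) * (dn el g l la * up el g l la) := by
          rw [hθ', h1, ← hθ']; simp only [mul_assoc]
      _ = el g := by rw [dL, dR, g4]
  have h4 : dn el g l la * y = dn el g r ra := by
    refine eq_dn_of_mul_up hg eR ?_ ?_ h3
    · rw [← mul_assoc, isModel_el.mul_dn _ _ hg]
    · simp only [hy, mul_assoc, ir]
  have h5 : y * up el g r ra = up el g l la := by
    refine eq_up_of_dn_mul hg eL ?_ ?_ (by rw [← mul_assoc, h3])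
    · simp only [hy, ← mul_assoc, il]
    · rw [mul_assoc, isModel_el.up_mul _ _ hg]
  have h6 : y = el l * el (anchor la) * el g * el (anchor ra.inv) * el r := by
    calc y = (y * up el g r ra) * (dn el g l la * y) := by
          conv_lhs => rw [← h2, ← hθ']
          simp only [mul_assoc]
      _ = el l * el (anchor la) * (el g * el g) * el (anchor ra.inv) * el r := by
          rw [h4, h5]; simp only [up, dn, mul_assoc]
      _ = _ := by rw [g4]
  calc u = (el c * (el (anchor la.inv) * el l * el (anchor la)) * u) *
          (el (anchor ra.inv) * el r * el (anchor ra)) * el c := by rw [u1, u2]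
    _ = el c * el (anchor la.inv) * y * el (anchor ra) * el c := by simp only [hy, mul_assoc]
    _ = (el c * (el (anchor la.inv) * el l * el (anchor la)) * el g) *
          (el (anchor ra.inv) * el r * el (anchor ra)) * el c := by
        rw [h6]; simp only [mul_assoc]
    _ = el g := by rw [g1, g2]

/-- An element with the defining property of an inverse of `x` is `x'`. -/
theorem eq_xinv {y : FOneOne} (h1 : el (anchor .x) * y * el (anchor .x) = el (anchor .x))
    (h2 : y * el (anchor .x) * y = y) : y = el (anchor .xinv) := by
  have hg := isModel_el.gxx_eq
  -- Both x y and then y `gxx` are identified as one-sided inverses of edges of `gxx`.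
  have h3 : el (anchor .x) * y = el gxx := by
    rw [← dn_gxx_left]
    refine eq_dn_of_mul_up gxx_mem isEdge_gxx_left ?_ ?_ ?_
    · rw [hg, ← mul_assoc, isModel_el.x_xinv_x]
    · rw [el_one, mul_one]
    · rw [up_gxx_left, hg, ← mul_assoc, h1]
  have h4 : y * el gxx = el (anchor .xinv) := by
    rw [← up_gxx_right]
    refine eq_up_of_dn_mul gxx_mem isEdge_gxx_right ?_ ?_ ?_
    · rw [el_one, one_mul]
    · rw [mul_assoc, isModel_el.idem gxx_mem]
    · rw [dn_gxx_right, ← mul_assoc, h3, isModel_el.idem gxx_mem]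
  rw [← h4, ← h3, ← mul_assoc, h2]

theorem hom_eq_id {F : FOneOne →* FOneOne} (hx : F (el (anchor .x)) = el (anchor .x))
    (u : FOneOne) : F u = u := by
  have hx' : F (el (anchor .xinv)) = el (anchor .xinv) := by
    apply eq_xinv
    · nth_rewrite 1 [← hx]
      nth_rewrite 2 [← hx]
      rw [← map_mul, ← map_mul, isModel_el.x_xinv_x, hx]
    · rw [← hx, ← map_mul, ← map_mul, isModel_el.xinv_x_xinv]
  have ha : ∀ a, F (el (anchor a)) = el (anchor a) := by
    rintro (_ | _ | _)
    exacts [by rw [el_one, map_one], hx, hx']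
  have hg : ∀ n, ∀ g ∈ GH n, F (el g) = el g := by
    intro n
    induction n using Nat.strong_induction_on with
    | _ n ih =>
      intro g hg
      match n, hg with
      | 0, hg => rw [mem_GH_zero.1 hg, ha]
      | 1, hg => rw [mem_GH_one.1 hg, isModel_el.gxx_eq, map_mul, ha, ha]
      | n + 2, hg =>
        obtain ⟨l, la, c, ra, r, rfl⟩ := exists_tuple hg
        obtain ⟨h1, h2, h3⟩ := entries_mem hg
        exact map_el_eq_of_entries ha hg (ih _ (by omega) _ h1) (ih _ (by omega) _ h2)
          (ih _ (by omega) _ h3)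
  induction u using el_induction with
  | h1 => exact map_one F
  | hx u ih => rw [map_mul, ih, hx]
  | hx' u ih => rw [map_mul, ih, hx']
  | hg u n g hgn ih => rw [map_mul, ih, hg n g hgn]

/-- The generator `x` of `F_1`. -/
noncomputable def xF1 : F1 :=
  ⟨el (anchor .x), fun h => by
    rw [el_anchor, cls_eq_one_iff, chi_w_of_ne (by simp [Gen.ofAnchor])] at h
    exact zero_ne_one h⟩

open Classical in
theorem endo_eq_id {F : F1 →ₙ* F1} (hx : F xF1 = xF1) (u : F1) : F u = u := by
  have h1 : ∀ u : F1, (u : FOneOne) ≠ 1 := fun u => u.2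
  -- Extending by 1 ↦ 1 is multiplicative because a product is 1 only if both factors are.
  let E : FOneOne →* FOneOne :=
    { toFun := fun u => if h : u = 1 then 1 else (F ⟨u, h⟩ : FOneOne)
      map_one' := by simp
      map_mul' := by
        intro u v
        by_cases hu : u = 1
        · simp [hu]
        · by_cases hv : v = 1
          · simp [hv]
          · have huv : u * v ≠ 1 := fun h => hu (eq_one_of_mul_eq_one h).1
            simp only [hu, hv, huv, dite_false]
            exact congrArg Subtype.val (map_mul F ⟨u, hu⟩ ⟨v, hv⟩) }
  have hE : ∀ u : F1, E u = F u := fun u => dif_neg (h1 u)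
  apply Subtype.ext
  rw [← hE]
  exact hom_eq_id ((hE xF1).trans (congrArg Subtype.val hx)) u

/-! ### Homomorphisms to regular semigroups -/

/-- The image of an anchor when `x` and `x'` are sent to given elements. -/
def anchorVal {N : Type*} [Monoid N] (x x' : N) : Anchor → N
  | .one => 1
  | .x => x
  | .xinv => x'

open Classical in
/-- The image of a letter, given a choice of inverses in the target. -/
noncomputable def letterVal {N : Type*} [Monoid N] (x x' : N) (inv : N → N) : Letter → N
  | anchor a => anchorVal x x' a
  | tuple l la c ra r => if c = anchor .x then x * x' else
      -- The argument of `inv` is the sandwich product θ. Idempotency uses θ*θθ* = θ*, and the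
      -- sandwich relation is θθ*θ = θ.
      letterVal x x' inv c * anchorVal x x' la.inv * letterVal x x' inv l *
      inv (letterVal x x' inv r * anchorVal x x' ra * letterVal x x' inv c *
        anchorVal x x' la.inv * letterVal x x' inv l) *
      letterVal x x' inv r * anchorVal x x' ra * letterVal x x' inv c

section letterVal

variable {N : Type*} [Monoid N] {x x' : N} {inv : N → N}

theorem letterVal_tuple {l c r : Letter} {la ra : Anchor} {n : ℕ}
    (h : tuple l la c ra r ∈ GH (n + 2)) : letterVal x x' inv (tuple l la c ra r) =
      letterVal x x' inv c * anchorVal x x' la.inv * letterVal x x' inv l *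
      inv (letterVal x x' inv r * anchorVal x x' ra * letterVal x x' inv c *
        anchorVal x x' la.inv * letterVal x x' inv l) *
      letterVal x x' inv r * anchorVal x x' ra * letterVal x x' inv c := by
  rw [letterVal, if_neg (ne_anchor_x (entries_mem h).2.1)]

theorem letterVal_gxx : letterVal x x' inv gxx = x * x' := by simp [gxx, letterVal]

theorem letterVal_idem (h1 : x * x' * x = x) (hi : ∀ t, inv t * t * inv t = inv t) {g : Letter}
    {n : ℕ} (h : g ∈ GH n) :
    letterVal x x' inv g * letterVal x x' inv g = letterVal x x' inv g := by
  induction n using Nat.strong_induction_on generalizing g with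
  | _ n ih =>
    match n, h with
    | 0, h => rw [mem_GH_zero.1 h]; exact one_mul _
    | 1, h => rw [mem_GH_one.1 h, letterVal_gxx, ← mul_assoc, h1]
    | n + 2, h =>
      obtain ⟨l, la, c, ra, r, rfl⟩ := exists_tuple h
      have hc := ih n (by omega) (entries_mem h).2.1
      rw [letterVal_tuple h]
      set C := letterVal x x' inv c
      set L := letterVal x x' inv l
      set R := letterVal x x' inv r
      set p := anchorVal x x' la.inv
      set q := anchorVal x x' ra
      calc _ = C * p * L * inv (R * q * C * p * L) * R * q * (C * C) * p * L *
            inv (R * q * C * p * L) * R * q * C := by simp only [mul_assoc]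
        _ = C * p * L * (inv (R * q * C * p * L) * (R * q * C * p * L) *
            inv (R * q * C * p * L)) * R * q * C := by rw [hc]; simp only [mul_assoc]
        _ = _ := by rw [hi]

/-- The absorption laws at a letter, given that the edges below its entries cancel. -/
theorem letterVal_absorb {l c r : Letter} {la ra : Anchor} {n : ℕ} (h : tuple l la c ra r ∈ GH (n + 2))
    (hl : letterVal x x' inv l * anchorVal x x' la * letterVal x x' inv c *
      anchorVal x x' la.inv * letterVal x x' inv l = letterVal x x' inv l)
    (hr : letterVal x x' inv r * anchorVal x x' ra * letterVal x x' inv c *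
      anchorVal x x' ra.inv * letterVal x x' inv r = letterVal x x' inv r) :
    letterVal x x' inv c * (anchorVal x x' la.inv * letterVal x x' inv l * anchorVal x x' la) *
      letterVal x x' inv (tuple l la c ra r) = letterVal x x' inv (tuple l la c ra r) ∧
    letterVal x x' inv (tuple l la c ra r) *
      (anchorVal x x' ra.inv * letterVal x x' inv r * anchorVal x x' ra) *
      letterVal x x' inv c = letterVal x x' inv (tuple l la c ra r) := by
  rw [letterVal_tuple h]
  generalize inv _ = t
  set C := letterVal x x' inv c
  set L := letterVal x x' inv l
  set R := letterVal x x' inv r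
  set p := anchorVal x x' la.inv
  set q := anchorVal x x' ra
  set P := anchorVal x x' la
  set Q := anchorVal x x' ra.inv
  constructor
  · calc _ = C * p * (L * P * C * p * L) * t * R * q * C := by simp only [mul_assoc]
      _ = _ := by rw [hl]
  · calc _ = C * p * L * t * (R * q * C * Q * R) * q * C := by simp only [mul_assoc]
      _ = _ := by rw [hr]

/-- Cancellation of the edges below the entries of g gives absorption at g, which in turn gives
cancellation of the edges below g; hence the induction on the level. -/
theorem letterVal_edge (h1 : x * x' * x = x) (hi : ∀ t, inv t * t * inv t = inv t)
    {g c : Letter} {a : Anchor} {n : ℕ} (h : g ∈ GH (n + 1)) (he : IsEdge g c a) :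
    letterVal x x' inv g * anchorVal x x' a.inv * letterVal x x' inv c * anchorVal x x' a *
      letterVal x x' inv g = letterVal x x' inv g := by
  have hi' := fun {k m} (hk : k ∈ GH m) => letterVal_idem (inv := inv) h1 hi hk
  induction n generalizing g c a with
  | zero =>
    have hg := hi' gxx_mem
    rw [mem_GH_one] at h
    subst h
    rcases he with he | he <;> cases he
    · change letterVal x x' inv gxx * 1 * 1 * 1 * letterVal x x' inv gxx = _
      simpa only [mul_one] using hg
    · change letterVal x x' inv gxx * x * 1 * x' * letterVal x x' inv gxx = _
      have e : x * x' = letterVal x x' inv gxx := letterVal_gxx.symm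
      rw [mul_one, mul_assoc _ x, e, hg, hg]
  | succ n ih =>
    obtain ⟨l, la, d, ra, r, rfl⟩ := exists_tuple h
    obtain ⟨hl, hd, hr⟩ := entries_mem h
    have el := ih hl (edges_of_mem h).1
    have er := ih hr (edges_of_mem h).2.1
    rw [Anchor.inv_inv] at el er
    obtain ⟨b1, b2⟩ := letterVal_absorb h el er
    have hg := hi' h
    have hd' := hi' hd
    set u := letterVal x x' inv (tuple l la d ra r)
    set C := letterVal x x' inv d
    have uC : u * C = u := by rw [← b2, mul_assoc _ C, hd']
    have Cu : C * u = u := by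
      conv_lhs => rw [← b1]
      rw [mul_assoc C, ← mul_assoc C C, hd', ← mul_assoc, b1]
    rcases he with he | he <;> cases he
    · calc _ = (u * C) * anchorVal x x' la.inv * letterVal x x' inv l * anchorVal x x' la * u := by
            rw [uC]; rfl
        _ = u * (C * (anchorVal x x' la.inv * letterVal x x' inv l * anchorVal x x' la) * u) := by
            simp only [mul_assoc]
        _ = u := by rw [b1, hg]
    · calc _ = u * anchorVal x x' ra.inv * letterVal x x' inv r * anchorVal x x' ra * (C * u) := by
            rw [Cu]; rfl
        _ = (u * (anchorVal x x' ra.inv * letterVal x x' inv r * anchorVal x x' ra) * C) * u := by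
            simp only [mul_assoc]
        _ = u := by rw [b2, hg]

theorem isModel_letterVal (h1 : x * x' * x = x) (h2 : x' * x * x' = x')
    (hi : ∀ t, inv t * t * inv t = inv t) (hi' : ∀ t, t * inv t * t = t) :
    IsModel (letterVal x x' inv) where
  one := rfl
  x_xinv_x := h1
  xinv_x_xinv := h2
  gxx_eq := letterVal_gxx
  idem := letterVal_idem h1 hi
  left_absorb {n l la c ra r} h := by
    have el := letterVal_edge h1 hi (entries_mem h).1 (edges_of_mem h).1
    have er := letterVal_edge h1 hi (entries_mem h).2.2 (edges_of_mem h).2.1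
    rw [Anchor.inv_inv] at el er
    exact (letterVal_absorb h el er).1
  right_absorb {n l la c ra r} h := by
    have el := letterVal_edge h1 hi (entries_mem h).1 (edges_of_mem h).1
    have er := letterVal_edge h1 hi (entries_mem h).2.2 (edges_of_mem h).2.1
    rw [Anchor.inv_inv] at el er
    exact (letterVal_absorb h el er).2
  sandwich {n l la c ra r} h := by
    rw [letterVal_tuple h]
    simp only [letterVal]
    set C := letterVal x x' inv c
    set L := letterVal x x' inv l
    set R := letterVal x x' inv r
    set p := anchorVal x x' la.inv
    set q := anchorVal x x' ra
    calc _ = (R * q * C * p * L) * inv (R * q * C * p * L) * (R * q * C * p * L) := by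
          simp only [mul_assoc]
      _ = _ := hi' _

end letterVal

theorem withOne_mul_eq_one {S : Type*} [Semigroup S] {a b : WithOne S} (h : a * b = 1) :
    a = 1 ∧ b = 1 := by
  induction a using WithOne.recOneCoe with
  | one => rw [one_mul] at h; exact ⟨rfl, h⟩
  | coe a =>
    induction b using WithOne.recOneCoe with
    | one => rw [mul_one] at h; exact ⟨h, rfl⟩
    | coe b => exact (WithOne.coe_ne_one h).elim

theorem IsRegularSemigroup.exists_inverse {S : Type*} [Semigroup S] (hS : IsRegularSemigroup S)
    (a : S) : ∃ b, a * b * a = a ∧ b * a * b = b := by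
  obtain ⟨b, hb⟩ := hS a
  refine ⟨b * a * b, ?_, ?_⟩
  · calc _ = a * b * a * b * a := by simp only [mul_assoc]
      _ = a := by rw [hb, hb]
  · calc _ = b * (a * b * a * b * a) * b := by simp only [mul_assoc]
      _ = _ := by rw [hb, hb]

theorem exists_inverse_withOne {S : Type*} [Semigroup S] (hS : IsRegularSemigroup S)
    (a : WithOne S) : ∃ b, a * b * a = a ∧ b * a * b = b := by
  induction a using WithOne.recOneCoe with
  | one => exact ⟨1, by simp, by simp⟩
  | coe a =>
    obtain ⟨b, h1, h2⟩ := IsRegularSemigroup.exists_inverse hS a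
    exact ⟨b, congrArg WithOne.coe h1, congrArg WithOne.coe h2⟩

/-- Each element of a regular semigroup is the image of `x` under a homomorphism from `F_1`. -/
theorem exists_hom_of_isRegular {S : Type*} [Semigroup S] (hS : IsRegularSemigroup S) (y : S) :
    ∃ F : F1 →ₙ* S, F xF1 = y := by
  obtain ⟨y', hy1, hy2⟩ := IsRegularSemigroup.exists_inverse hS y
  choose inv hi' hi using exists_inverse_withOne hS
  -- The identity is adjoined even if S already has one: then a product is 1 only if all factors
  -- are, so F_1 maps into S.
  set f : Letter → WithOne S := letterVal (y : WithOne S) (y' : WithOne S) inv with hf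
  have hm : IsModel f :=
    isModel_letterVal (congrArg WithOne.coe hy1) (congrArg WithOne.coe hy2) hi hi'
  obtain ⟨F, hF⟩ := hm.exists_hom
  have hne : ∀ n, ∀ g ∈ GH (n + 1), f g ≠ 1 := by
    intro n
    induction n with
    | zero =>
      intro g hg
      rw [mem_GH_one.1 hg, hf, letterVal_gxx]
      exact fun h => WithOne.coe_ne_one (withOne_mul_eq_one h).1
    | succ n ih =>
      intro g hg h
      obtain ⟨l, la, c, ra, r, rfl⟩ := exists_tuple hg
      rw [hf, letterVal_tuple hg] at h
      have h3 := (withOne_mul_eq_one (withOne_mul_eq_one (withOne_mul_eq_one h).1).1).2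
      exact ih r (entries_mem hg).2.2 h3
  have key : ∀ u : FreeSemigroup Gen, F (cls u) = 1 → cls u = 1 := by
    intro u
    induction u with
    | ih1 g =>
      intro h
      change F (cls (w g)) = 1 at h
      rw [hF] at h
      obtain ⟨g, ⟨a, rfl⟩ | ⟨n, hn, hg⟩⟩ := g
      · cases a with
        | one => rfl
        | x => exact (WithOne.coe_ne_one h).elim
        | xinv => exact (WithOne.coe_ne_one h).elim
      · obtain ⟨m, rfl⟩ := Nat.exists_eq_add_of_le' hn
        exact (hne m g hg h).elim
    | ih2 g v hg hv =>
      intro h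
      rw [cls_mul, map_mul] at h
      obtain ⟨e1, e2⟩ := withOne_mul_eq_one h
      rw [cls_mul, hg e1, hv e2, one_mul]
  have hne' : ∀ u : F1, F u ≠ 1 := by
    rintro ⟨u, hu⟩ h
    obtain ⟨u, rfl⟩ := cls_surjective u
    exact hu (key u h)
  refine ⟨⟨fun u => WithOne.unone (hne' u), fun u v => ?_⟩, ?_⟩
  · apply WithOne.coe_inj.1
    rw [WithOne.coe_mul, WithOne.coe_unone, WithOne.coe_unone, WithOne.coe_unone]
    exact map_mul F u.1 v.1
  · apply WithOne.coe_inj.1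
    change ((WithOne.unone (hne' xF1) : S) : WithOne S) = y
    rw [WithOne.coe_unone]
    change F (el (anchor .x)) = _
    rw [el_anchor, hF]
    rfl

/-! ### The universal property -/

/-- A regular subsemigroup containing x receives a homomorphism from F_1 fixing x. By rigidity its
composite with the inclusion is the identity, so the inclusion is onto. -/
theorem isRegularWeaklyGeneratedBy_xF1 : IsRegularWeaklyGeneratedBy F1 xF1 := by
  refine ⟨isRegular_F1, fun R hx hR => ?_⟩
  obtain ⟨F, hF⟩ := exists_hom_of_isRegular hR ⟨xF1, hx⟩
  have h : ∀ u, ((F u : R) : F1) = u :=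
    endo_eq_id (F := (MulMemClass.subtype R).comp F) (congrArg Subtype.val hF)
  exact eq_top_iff.2 fun u _ => h u ▸ (F u).2

theorem IsRegularSemigroup.srange {S T : Type*} [Semigroup S] [Semigroup T]
    (hS : IsRegularSemigroup S) (F : S →ₙ* T) : IsRegularSemigroup F.srange := by
  rintro ⟨_, a, rfl⟩
  obtain ⟨b, hb⟩ := hS a
  refine ⟨⟨F b, b, rfl⟩, Subtype.ext ?_⟩
  change F a * F b * F a = F a
  rw [← map_mul, ← map_mul, hb]

theorem IsRegularWeaklyGeneratedBy.of_mulEquiv {S T : Type*} [Semigroup S] [Semigroup T] {x : S}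
    (hS : IsRegularWeaklyGeneratedBy S x) (e : S ≃* T) : IsRegularWeaklyGeneratedBy T (e x) := by
  refine ⟨fun t => ?_, fun R hx hR => ?_⟩
  · obtain ⟨b, hb⟩ := hS.1 (e.symm t)
    exact ⟨e b, e.symm.injective (by simpa using hb)⟩
  · have h := hS.2 (R.comap e.toMulHom) hx ?_
    · refine eq_top_iff.2 fun t _ => ?_
      have ht : e.symm t ∈ R.comap e.toMulHom := h ▸ Subsemigroup.mem_top _
      have ht' : e (e.symm t) ∈ R := ht
      rwa [e.apply_symm_apply] at ht'
    · rintro ⟨a, ha⟩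
      obtain ⟨⟨b, hb⟩, hab⟩ := hR ⟨e a, ha⟩
      have hb' : e (e.symm b) ∈ R := by rwa [e.apply_symm_apply]
      refine ⟨⟨e.symm b, hb'⟩, Subtype.ext (e.injective ?_)⟩
      change e (a * e.symm b * a) = e a
      rw [map_mul, map_mul, e.apply_symm_apply]
      exact congrArg Subtype.val hab

end FOne

theorem mainTheorem5 {T : Type*} [Semigroup T] (x : T)
    (hT : IsRegularWeaklyGeneratedBy T x)
    (huniv : ∀ (S : Type*) [Semigroup S] (y : S), IsRegularWeaklyGeneratedBy S y →
      ∃ φ : T →ₙ* S, Function.Surjective φ ∧ φ x = y) :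
    Nonempty (T ≃* FOne.F1) := by
  obtain ⟨ψ, hψ⟩ := FOne.exists_hom_of_isRegular hT.1 x
  have hsurj : Function.Surjective ψ := by
    have h := hT.2 ψ.srange ⟨_, hψ⟩ (FOne.IsRegularSemigroup.srange FOne.isRegular_F1 ψ)
    exact fun t => (h ▸ Subsemigroup.mem_top t : t ∈ ψ.srange)
  -- The lift moves F_1 into the universe over which the universality hypothesis quantifies.
  obtain ⟨φ, -, hφ⟩ := huniv (ULift FOne.F1) (ULift.up FOne.xF1)
    (FOne.IsRegularWeaklyGeneratedBy.of_mulEquiv FOne.isRegularWeaklyGeneratedBy_xF1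
      MulEquiv.ulift.symm)
  have hid : ∀ u, MulEquiv.ulift (φ (ψ u)) = u :=
    FOne.endo_eq_id (F := (MulEquiv.ulift.toMulHom.comp φ).comp ψ) (by
      change MulEquiv.ulift (φ (ψ FOne.xF1)) = FOne.xF1
      rw [hψ, hφ]
      rfl)
  have hinj : Function.Injective ψ := fun u v h => by rw [← hid u, h, hid v]
  exact ⟨(MulEquiv.ofBijective ψ ⟨hinj, hsurj⟩).symm⟩
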